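/- Let $n\ge 0$ be an integer and let $\alpha,\mu,\zeta\in\mathbb C$ with $\operatorname{Re}\alpha>-1$, $\operatorname{Re}\mu>-1$ (for instance all real with $\zeta<1$). For $t>0$ consider on $(0,\infty)$ the weight $$w_t(x)=(1-\zeta\,\theta(x-t))\,(x-t)^\alpha x^\mu e^{-x},$$ where $\theta(y)=1$ for $y>0$, $\theta(y)=0$ otherwise, and $(x-t)^\alpha$ is the principal power. Let $U\subseteq(0,\infty)$ be open and suppose that for every $t\in U$ there are polynomials $p_0,\dots,p_{n+1}$, $\deg p_k=k$, with $\int_0^\infty p_i(x)p_j(x)w_t(x)\,dx=\delta_{ij}$ for $0\le i,j\le n+1$. Let $a_k=a_k(t)$, $b_k=b_k(t)$ be the coefficients in the three term recurrence $$a_{k+1}p_{k+1}=(x-b_k)p_k-a_kp_{k-1}\quad(0\le k\le n),\qquad a_0=0,$$ and put $$\theta_n=b_n-2n-1-\alpha-\mu-t,\qquad \kappa_n=\Big(n+\frac\mu2\Big)t+a_n^2-\sum_{i=0}^{n-1}b_i .$$ Let $v_1+v_2+v_3+v_4=0$ with $$v_2-v_1=-\mu,\quad v_3-v_4=\alpha,\quad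 v_2-v_4=n+\alpha+1,\quad v_2-v_3=n+1,$$ and let $H=H(t,q,p)$ be given by $$tH=q(q-1)^2p^2-\big((v_2-v_1)(q-1)^2-2(v_1+v_2)q(q-1)+tq\big)p+(v_3-v_1)(v_4-v_1)(q-1).$$ Then at every $t\in U$ with $\theta_n(t)\neq0$ and $\theta_n(t)+t\ne0$ the following hold. (1) The Hamilton equations $q'=\partial H/\partial p$, $p'=-\partial H/\partial q$ (with $'=d/dt$) are satisfied by $$q=\frac{\theta_n}{\theta_n+t},\qquad p=\frac{(\theta_n+t)\big(\kappa_n-\frac{\mu t}{2}+\theta_n(1+2n+t+\alpha+\mu+\theta_n)\big)}{t\,\theta_n}.$$ (2) $q$ is twice differentiable and satisfies the fifth Painlevé equation $$y''=\Big(\frac1{2y}+\frac1{y-1}\Big)(y')^2-\frac{y'}t+\frac{(y-1)^2}{t^2}\Big(\alpha_1y+\frac{\alpha_2}{y}\Big)+\frac{\alpha_3y}{t}+\frac{\alpha_4y(y+1)}{y-1}$$ with $\alpha_1=\frac{\alpha^2}2$, $\alpha_2=-\frac{\mu^2}2$, $\alpha_3=2n+\alpha+1+\mu$, $\alpha_4=-\frac12$.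 (3) Equivalently, in the variable $s=-t$: $(q(-s),p(-s))$ satisfies the Hamilton equations of the Hamiltonian $K$ defined by $sK(s,q,p)=(tH)|_{t=-s}$, i.e. $K(s,q,p)=-H(-s,q,p)$, and $q(-s)$ satisfies the fifth Painlevé equation in $s$ with the same $\alpha_1,\alpha_2,\alpha_4$ and with $\alpha_3$ replaced by $-\alpha_3$. (4) Consequently $$\theta_n=\frac{tq}{1-q},\qquad \kappa_n=tpq-\frac{t^2}{(1-q)^2}+\frac{t\big(t+\frac\mu2-q(2n+\alpha+1+\frac{3\mu}2)\big)}{1-q}.$$ -/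

import Mathlib

open Filter Topology MeasureTheory Polynomial

namespace LaguerrePV

noncomputable section

/-- The Heaviside step function: `1` on positive reals and `0` elsewhere. -/
def heaviside (y : ℝ) : ℂ := if 0 < y then 1 else 0

/-- The discontinuous semi-classical Laguerre weight
`w(x) = (1 - ζ θ(x - t)) (x - t)^α x^μ e^{-x}`, to be used on `x > 0`.
Powers are principal-branch complex powers, so that `(x - t)^α` is the usual
power for `x > t` or for `α` a natural number. -/
def weight (α μ ζ : ℂ) (t x : ℝ) : ℂ :=
  (1 - ζ * heaviside (x - t)) * ((x - t : ℝ) : ℂ) ^ α * (x : ℂ) ^ μ * Complex.exp (-(x : ℂ))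

/-- The bilinear form `⟨f, g⟩ = ∫_0^∞ f(x) g(x) w(x) dx` on polynomials (no conjugation). -/
def bilin (w : ℝ → ℂ) (f g : ℂ[X]) : ℂ :=
  ∫ x in Set.Ioi (0 : ℝ), f.eval (x : ℂ) * g.eval (x : ℂ) * w x

/-- `P 0, …, P N` are orthonormal polynomials for the weight `w`, with `P k` of degree `k`. -/
structure IsOrthonormalUpTo (w : ℝ → ℂ) (N : ℕ) (P : ℕ → ℂ[X]) : Prop where
  degree_eq : ∀ k ≤ N, (P k).degree = k
  orthonormal : ∀ i ≤ N, ∀ j ≤ N, bilin w (P i) (P j) = if i = j then 1 else 0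

/-- `a`, `b` are the coefficients in the three term recurrence
`a_{k+1} p_{k+1} = (x - b_k) p_k - a_k p_{k-1}` for `k < N`, with `a_0 = 0`
(so the term with `p_{-1}` is absent for `k = 0`). -/
structure IsRecurrenceUpTo (N : ℕ) (P : ℕ → ℂ[X]) (a b : ℕ → ℂ) : Prop where
  a_zero : a 0 = 0
  recurrence : ∀ k < N,
    C (a (k + 1)) * P (k + 1) = (X - C (b k)) * P k - C (a k) * P (k - 1)

/-- `θ_n = b_n - 2n - 1 - α - μ - t`. -/
def thetaFn (α μ : ℂ) (b : ℝ → ℕ → ℂ) (n : ℕ) (t : ℝ) : ℂ :=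
  b t n - 2 * n - 1 - α - μ - t

/-- `κ_n = (n + μ/2) t + a_n² - ∑_{i<n} b_i`. -/
def kappaFn (μ : ℂ) (a b : ℝ → ℕ → ℂ) (n : ℕ) (t : ℝ) : ℂ :=
  (n + μ / 2) * t + a t n ^ 2 - ∑ i ∈ Finset.range n, b t i

/-- The Hamiltonian of the fifth Painlevé equation:
`t H = q(q-1)²p² - ((v₂-v₁)(q-1)² - 2(v₁+v₂)q(q-1) + tq) p + (v₃-v₁)(v₄-v₁)(q-1)`. -/
def hamiltonianPV (v₁ v₂ v₃ v₄ : ℂ) (t : ℝ) (q p : ℂ) : ℂ :=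
  (q * (q - 1) ^ 2 * p ^ 2
    - ((v₂ - v₁) * (q - 1) ^ 2 - 2 * (v₁ + v₂) * q * (q - 1) + t * q) * p
    + (v₃ - v₁) * (v₄ - v₁) * (q - 1)) / t

/-- The Hamilton equations `q' = ∂H/∂p`, `p' = -∂H/∂q` hold at the time `t`. -/
def SatisfiesHamiltonAt (H : ℝ → ℂ → ℂ → ℂ) (q p : ℝ → ℂ) (t : ℝ) : Prop :=
  HasDerivAt q (deriv (fun y : ℂ => H t (q t) y) (p t)) t ∧
  HasDerivAt p (-deriv (fun x : ℂ => H t x (p t)) (q t)) t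

/-- The function `y` of a real variable is twice differentiable at `t` and satisfies there
the fifth Painlevé equation
`y'' = (1/(2y) + 1/(y-1)) y'² - y'/t + (y-1)²/t² (α₁ y + α₂/y) + α₃ y/t + α₄ y(y+1)/(y-1)`,
all of whose denominators are nonzero. -/
def SatisfiesPVAt (α₁ α₂ α₃ α₄ : ℂ) (y : ℝ → ℂ) (t : ℝ) : Prop :=
  t ≠ 0 ∧ y t ≠ 0 ∧ y t ≠ 1 ∧
  (∀ᶠ s in 𝓝 t, DifferentiableAt ℝ y s) ∧ DifferentiableAt ℝ (deriv y) t ∧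
  deriv (deriv y) t =
    (1 / (2 * y t) + 1 / (y t - 1)) * deriv y t ^ 2 - deriv y t / t
    + (y t - 1) ^ 2 / (t : ℂ) ^ 2 * (α₁ * y t + α₂ / y t)
    + α₃ * y t / t + α₄ * y t * (y t + 1) / (y t - 1)

/-- `q = θ_n / (θ_n + t)`. -/
def qFn (α μ : ℂ) (b : ℝ → ℕ → ℂ) (n : ℕ) (t : ℝ) : ℂ :=
  thetaFn α μ b n t / (thetaFn α μ b n t + t)

/-- `p = (θ_n + t) (κ_n - μt/2 + θ_n (1 + 2n + t + α + μ + θ_n)) / (t θ_n)`. -/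
def pFn (α μ : ℂ) (a b : ℝ → ℕ → ℂ) (n : ℕ) (t : ℝ) : ℂ :=
  (thetaFn α μ b n t + t) *
    (kappaFn μ a b n t - μ * t / 2
      + thetaFn α μ b n t * (1 + 2 * n + t + α + μ + thetaFn α μ b n t))
    / (t * thetaFn α μ b n t)

end

end LaguerrePV

/-! The substitution `x = t y` moves the singularity to the fixed point `1`, so each moment is a
power of `t` times a Laplace transform. Two facts about the moments follow. One is the Pearson
relation `L(σ f' + τ f) = 0` with `σ = x (x - t)`. The other is `t m_k' = (α + μ + k + 1) m_k -
m_{k+1}`. Neither contains `ζ`, because the boundary terms vanish on both sides of the jump. Nothing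
else about the weight is used afterwards.

For the monic polynomials `Q_k`, the Pearson relation gives `σ Q_n' = (n x + …) Q_n + a_n² (x + θ_n)
Q_{n-1}` (`structure_relation`) and a Laguerre–Freud equation. At the zeros `0` and `t` of `σ` the
left side vanishes, so a two by two determinant must vanish (`det_eq_zero`). This gives the formulas
of `quadratic_relations` for `a_n² θ_n θ_{n-1}` and `a_n² (θ_n + t) (θ_{n-1} + t)`.

The moment derivatives give Toda-type equations for `b_n` and `a_n²`. Eliminating `a_{n+1}²`, `a_n²`
and `a_n² θ_{n-1}` leaves a closed first order system for `(θ_n, κ_n)`. The pair `(q, p)` is a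
birational change of these variables, so the Hamilton equations become rational identities.
Differentiating `q'` once more gives the fifth Painlevé equation. -/

namespace LaguerrePV
noncomputable section

/-! ### The rescaled weight and its Laplace transform. -/

/-- The kernel `(y - 1)^α y^μ e^{-sy}`. -/
def jacobiExpKernel (α μ : ℂ) (s y : ℝ) : ℂ :=
  ((y - 1 : ℝ) : ℂ) ^ α * (y : ℂ) ^ μ * Complex.exp (-(s * y : ℝ))

/-- The two-sided multiplicative constant of the weight. -/
def jumpFactor (ζ : ℂ) (y : ℝ) : ℂ := 1 - ζ * heaviside (y - 1)

/-- The Laplace transform of the rescaled weight. -/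
def scaledMoment (α μ ζ : ℂ) (s : ℝ) : ℂ :=
  ∫ y in Set.Ioi (0 : ℝ), jumpFactor ζ y * jacobiExpKernel α μ s y

lemma jacobiExpKernel_add_one {α μ : ℂ} {s y : ℝ} (hy : 0 < y) :
    jacobiExpKernel α (μ + 1) s y = y * jacobiExpKernel α μ s y := by
  have : (y : ℂ) ≠ 0 := by exact_mod_cast hy.ne'
  unfold jacobiExpKernel
  rw [Complex.cpow_add _ _ this, Complex.cpow_one]; ring

lemma jacobiExpKernel_isBigO (α μ : ℂ) {s : ℝ} (hs : 0 < s) :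
    jacobiExpKernel α μ s =O[atTop] fun y => Real.exp (-(s / 2) * y) := by
  -- Each power costs at most a quarter of the rate `s`, which leaves decay at rate `s / 2`.
  have h1 : (fun y : ℝ => (y - 1) ^ α.re) =O[atTop] fun y => Real.exp (s / 4 * (y - 1)) :=
    ((isLittleO_rpow_exp_pos_mul_atTop α.re (by positivity : 0 < s / 4)).comp_tendsto
      (tendsto_atTop_add_const_right atTop (-1 : ℝ) tendsto_id)).isBigO
  have h2 : (fun y : ℝ => y ^ μ.re) =O[atTop] fun y => Real.exp (s / 4 * y) :=
    (isLittleO_rpow_exp_pos_mul_atTop μ.re (by positivity)).isBigO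
  have h3 := (h1.mul h2).mul (Asymptotics.isBigO_refl (fun y : ℝ => Real.exp (-(s * y))) atTop)
  have h4 : (fun y : ℝ => Real.exp (s / 4 * (y - 1)) * Real.exp (s / 4 * y) *
      Real.exp (-(s * y))) = fun y => Real.exp (-(s / 4)) * Real.exp (-(s / 2) * y) := by
    funext y
    rw [← Real.exp_add, ← Real.exp_add, ← Real.exp_add]
    congr 1; ring
  rw [h4] at h3
  refine (Asymptotics.IsBigO.of_norm_left ?_).trans
    (Asymptotics.isBigO_const_mul_self (Real.exp (-(s / 4))) _ _)
  refine h3.congr' ?_ EventuallyEq.rfl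
  filter_upwards [eventually_gt_atTop 1] with y hy
  rw [jacobiExpKernel, norm_mul, norm_mul, Complex.norm_cpow_eq_rpow_re_of_pos (by linarith),
    Complex.norm_cpow_eq_rpow_re_of_pos (by linarith), Complex.norm_exp]
  simp

lemma jacobiExpKernel_continuousOn (α μ : ℂ) (s : ℝ) :
    ContinuousOn (jacobiExpKernel α μ s) (Set.Ioi 1) := by
  intro y hy
  have hy : 1 < y := hy
  have h1 : ContinuousAt (fun y : ℝ => ((y - 1 : ℝ) : ℂ) ^ α) y :=
    ContinuousAt.comp (f := fun y : ℝ => y - 1) (g := fun y : ℝ => (y : ℂ) ^ α)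
      (Complex.continuousAt_ofReal_cpow_const _ _ (Or.inr (by linarith))) (by fun_prop)
  have h2 : ContinuousAt (fun y : ℝ => (y : ℂ) ^ μ) y :=
    Complex.continuousAt_ofReal_cpow_const _ _ (Or.inr (by linarith))
  have h3 : ContinuousAt (fun y : ℝ => Complex.exp (-(s * y : ℝ))) y := by fun_prop
  exact ((h1.mul h2).mul h3).continuousWithinAt

lemma jacobiExpKernel_integrableOn {α μ : ℂ} (hα : -1 < α.re) (hμ : -1 < μ.re) {s : ℝ}
    (hs : 0 < s) : IntegrableOn (jacobiExpKernel α μ s) (Set.Ioi 0) := by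
  have hA : ∀ a b : ℝ, IntervalIntegrable (fun y : ℝ => ((y - 1 : ℝ) : ℂ) ^ α) volume a b := by
    intro a b
    have := (intervalIntegral.intervalIntegrable_cpow' (a := a - 1) (b := b - 1) hα).comp_sub_right 1
    simpa using this
  have hM : ∀ a b : ℝ, IntervalIntegrable (fun y : ℝ => (y : ℂ) ^ μ) volume a b :=
    fun a b => intervalIntegral.intervalIntegrable_cpow' hμ
  have hE : Continuous (fun y : ℝ => Complex.exp (-(s * y : ℝ))) := by fun_prop
  -- Cutting at `1/2` and `2` leaves at most one singular factor on each piece.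
  have h1 : IntervalIntegrable (jacobiExpKernel α μ s) volume 0 (1 / 2) := by
    refine IntervalIntegrable.mul_continuousOn ?_ hE.continuousOn
    refine (hM _ _).continuousOn_mul ?_
    intro y hy
    rw [Set.uIcc_of_le (by norm_num)] at hy
    refine ContinuousAt.continuousWithinAt (ContinuousAt.comp (f := fun y : ℝ => y - 1)
      (g := fun y : ℝ => (y : ℂ) ^ α)
      (Complex.continuousAt_ofReal_cpow_const _ _ (Or.inr ?_)) (by fun_prop))
    have := hy.2
    linarith
  have h2 : IntervalIntegrable (jacobiExpKernel α μ s) volume (1 / 2) 2 := by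
    refine IntervalIntegrable.mul_continuousOn ?_ hE.continuousOn
    refine (hA _ _).mul_continuousOn ?_
    intro y hy
    rw [Set.uIcc_of_le (by norm_num)] at hy
    refine ContinuousAt.continuousWithinAt
      (Complex.continuousAt_ofReal_cpow_const _ _ (Or.inr ?_))
    have := hy.1
    linarith
  have h3 : IntegrableOn (jacobiExpKernel α μ s) (Set.Ioi 2) := by
    have hc : ContinuousOn (jacobiExpKernel α μ s) (Set.Ici 2) :=
      (jacobiExpKernel_continuousOn α μ s).mono fun y hy =>
        lt_of_lt_of_le (one_lt_two : (1 : ℝ) < 2) hy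
    have := integrable_of_isBigO_exp_neg (f := fun y => ‖jacobiExpKernel α μ s y‖) (a := 2)
      (b := s / 2) (by positivity) hc.norm (jacobiExpKernel_isBigO α μ hs).norm_left
    exact (integrable_norm_iff ((hc.mono Set.Ioi_subset_Ici_self).aestronglyMeasurable
      measurableSet_Ioi)).1 this
  have h4 := h1.trans h2
  rw [intervalIntegrable_iff_integrableOn_Ioc_of_le (by norm_num)] at h4
  have := h4.union h3
  rwa [Set.Ioc_union_Ioi_eq_Ioi (by norm_num)] at this

lemma measurable_jumpFactor (ζ : ℂ) : Measurable (jumpFactor ζ) := by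
  unfold jumpFactor heaviside
  refine measurable_const.sub (measurable_const.mul ?_)
  exact Measurable.ite (measurableSet_lt measurable_const (by fun_prop)) measurable_const
    measurable_const

lemma norm_jumpFactor_le (ζ : ℂ) (y : ℝ) : ‖jumpFactor ζ y‖ ≤ 1 + ‖ζ‖ := by
  unfold jumpFactor heaviside
  refine (norm_sub_le _ _).trans ?_
  split_ifs <;> simp

lemma scaledMoment_integrableOn {α μ : ℂ} (ζ : ℂ) (hα : -1 < α.re) (hμ : -1 < μ.re) {s : ℝ}
    (hs : 0 < s) :
    IntegrableOn (fun y => jumpFactor ζ y * jacobiExpKernel α μ s y) (Set.Ioi 0) :=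
  (jacobiExpKernel_integrableOn hα hμ hs).bdd_mul (c := 1 + ‖ζ‖)
    (measurable_jumpFactor ζ).aestronglyMeasurable (ae_of_all _ (norm_jumpFactor_le ζ))

lemma jacobiExpKernel_hasDerivAt {α μ : ℂ} (hα : -1 < α.re) (hμ : -1 < μ.re) (s : ℝ) {y : ℝ}
    (hy : 0 < y) (hy1 : y ≠ 1) :
    HasDerivAt (jacobiExpKernel (α + 1) (μ + 1) s)
      (((α + 1) * y + (μ + 1) * (y - 1) - s * y * (y - 1)) * jacobiExpKernel α μ s y) y := by
  have e1 : α + 1 ≠ 0 := fun h => by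
    have := congrArg Complex.re h
    simp at this; linarith
  have e2 : μ + 1 ≠ 0 := fun h => by
    have := congrArg Complex.re h
    simp at this; linarith
  have hyc : (y : ℂ) ≠ 0 := by exact_mod_cast hy.ne'
  have hyc1 : ((y - 1 : ℝ) : ℂ) ≠ 0 := by exact_mod_cast sub_ne_zero.2 hy1
  have h1 : HasDerivAt (fun y : ℝ => ((y - 1 : ℝ) : ℂ) ^ (α + 1))
      ((α + 1) * ((y - 1 : ℝ) : ℂ) ^ α) y := by
    have := (hasDerivAt_ofReal_cpow_const (x := y - 1) (sub_ne_zero.2 hy1) e1).comp_sub_const y 1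
    simpa using this
  have h2 : HasDerivAt (fun y : ℝ => (y : ℂ) ^ (μ + 1)) ((μ + 1) * (y : ℂ) ^ μ) y := by
    simpa using hasDerivAt_ofReal_cpow_const hy.ne' e2
  have h3 : HasDerivAt (fun y : ℝ => Complex.exp (-(s * y : ℝ)))
      (Complex.exp (-(s * y : ℝ)) * (-(s : ℂ))) y := by
    refine HasDerivAt.cexp ?_
    have := (((hasDerivAt_id y).const_mul s).ofReal_comp).fun_neg
    simpa using this
  refine ((h1.fun_mul h2).fun_mul h3).congr_deriv ?_
  simp only [jacobiExpKernel]
  rw [Complex.cpow_add _ _ hyc, Complex.cpow_add _ _ hyc1, Complex.cpow_one, Complex.cpow_one]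
  push_cast
  ring

lemma jacobiExpKernel_continuous {α μ : ℂ} (hα : 0 < α.re) (hμ : 0 < μ.re) (s : ℝ) :
    Continuous (jacobiExpKernel α μ s) := by
  have h1 := (Complex.continuous_ofReal_cpow_const hα).comp (continuous_sub_right (1 : ℝ))
  have h3 : Continuous (fun y : ℝ => Complex.exp (-(s * y : ℝ))) := by fun_prop
  exact (h1.mul (Complex.continuous_ofReal_cpow_const hμ)).mul h3

/-- Raising both exponents by one makes the primitive continuous and zero at `0`, `1` and infinity.
The integrals to the left and to the right of `1` therefore vanish separately, which is what makes
the jump harmless. -/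
lemma integral_deriv_jacobiExpKernel {α μ : ℂ} (hα : -1 < α.re) (hμ : -1 < μ.re) {s : ℝ}
    (hs : 0 < s) {g : ℝ → ℂ} (hg : IntegrableOn g (Set.Ioi 0))
    (hd : ∀ y, 0 < y → y ≠ 1 → HasDerivAt (jacobiExpKernel (α + 1) (μ + 1) s) (g y) y) :
    ∫ y in (0 : ℝ)..1, g y = 0 ∧ ∫ y in Set.Ioi (1 : ℝ), g y = 0 := by
  have r1 : 0 < (α + 1).re := by simp; linarith
  have r2 : 0 < (μ + 1).re := by simp; linarith
  have e1 : α + 1 ≠ 0 := fun h => by simp [h] at r1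
  have e2 : μ + 1 ≠ 0 := fun h => by simp [h] at r2
  have hc := jacobiExpKernel_continuous r1 r2 s
  have v0 : jacobiExpKernel (α + 1) (μ + 1) s 0 = 0 := by
    simp [jacobiExpKernel, Complex.zero_cpow e2]
  have v1 : jacobiExpKernel (α + 1) (μ + 1) s 1 = 0 := by
    simp [jacobiExpKernel, Complex.zero_cpow e1]
  constructor
  · rw [intervalIntegral.integral_eq_sub_of_hasDerivAt_of_le zero_le_one hc.continuousOn
      (fun y hy => hd y hy.1 hy.2.ne), v0, v1, sub_zero]
    rw [intervalIntegrable_iff_integrableOn_Ioc_of_le zero_le_one]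
    exact hg.mono_set Set.Ioc_subset_Ioi_self
  · rw [integral_Ioi_of_hasDerivAt_of_tendsto (m := 0) hc.continuousWithinAt
      (fun y hy => hd y (zero_lt_one.trans hy) (ne_of_gt hy))
      (hg.mono_set (Set.Ioi_subset_Ioi zero_le_one)), v1, sub_zero]
    refine (jacobiExpKernel_isBigO _ _ hs).trans_tendsto ?_
    refine Real.tendsto_exp_atBot.comp ?_
    exact tendsto_id.const_mul_atTop_of_neg (by linarith)

lemma scaledMoment_pearson {α μ : ℂ} (ζ : ℂ) (hα : -1 < α.re) (hμ : -1 < μ.re) {s : ℝ}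
    (hs : 0 < s) :
    (α + μ + 2 + s) * scaledMoment α (μ + 1) ζ s - (μ + 1) * scaledMoment α μ ζ s
      - s * scaledMoment α (μ + 2) ζ s = 0 := by
  have hμ1 : -1 < (μ + 1).re := by simp; linarith
  have hμ2 : -1 < (μ + 2).re := by simp; linarith
  set K : ℝ → ℂ := fun y => (α + μ + 2 + s) * jacobiExpKernel α (μ + 1) s y
    - (μ + 1) * jacobiExpKernel α μ s y - s * jacobiExpKernel α (μ + 2) s y with hK
  have hKi : IntegrableOn K (Set.Ioi 0) :=
    (((jacobiExpKernel_integrableOn hα hμ1 hs).const_mul _).sub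
      ((jacobiExpKernel_integrableOn hα hμ hs).const_mul _)).sub
      ((jacobiExpKernel_integrableOn hα hμ2 hs).const_mul _)
  have hKd : ∀ y, 0 < y → y ≠ 1 →
      HasDerivAt (jacobiExpKernel (α + 1) (μ + 1) s) (K y) y := by
    intro y hy hy1
    refine (jacobiExpKernel_hasDerivAt hα hμ s hy hy1).congr_deriv ?_
    simp only [hK]
    rw [show μ + 2 = μ + 1 + 1 by ring, jacobiExpKernel_add_one (μ := μ + 1) hy,
      jacobiExpKernel_add_one hy]
    ring
  obtain ⟨hI0, hI1⟩ := integral_deriv_jacobiExpKernel hα hμ hs hKi hKd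
  have hcK : IntegrableOn (fun y => jumpFactor ζ y * K y) (Set.Ioi 0) :=
    hKi.bdd_mul (c := 1 + ‖ζ‖) (measurable_jumpFactor ζ).aestronglyMeasurable
      (ae_of_all _ (norm_jumpFactor_le ζ))
  -- The jump factor is constant on each side of `1`, so it comes out of two integrals that are
  -- already zero.
  have hsum : ∫ y in Set.Ioi (0 : ℝ), jumpFactor ζ y * K y = 0 := by
    rw [← Set.Ioc_union_Ioi_eq_Ioi (zero_le_one (α := ℝ)), setIntegral_union
      (Set.Ioc_disjoint_Ioi le_rfl) measurableSet_Ioi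
      (hcK.mono_set Set.Ioc_subset_Ioi_self) (hcK.mono_set (Set.Ioi_subset_Ioi zero_le_one))]
    have a1 : ∫ y in Set.Ioc (0 : ℝ) 1, jumpFactor ζ y * K y
        = ∫ y in Set.Ioc (0 : ℝ) 1, 1 * K y := by
      refine setIntegral_congr_fun measurableSet_Ioc fun y hy => ?_
      simp [jumpFactor, heaviside, not_lt.2 (sub_nonpos.2 hy.2)]
    have a2 : ∫ y in Set.Ioi (1 : ℝ), jumpFactor ζ y * K y
        = ∫ y in Set.Ioi (1 : ℝ), (1 - ζ) * K y := by
      refine setIntegral_congr_fun measurableSet_Ioi fun y hy => ?_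
      have : (1 : ℝ) < y := hy
      simp [jumpFactor, heaviside, this]
    rw [a1, a2, integral_const_mul, integral_const_mul, hI1,
      ← intervalIntegral.integral_of_le zero_le_one, hI0]
    simp
  rw [← hsum]
  unfold scaledMoment
  rw [← integral_const_mul, ← integral_const_mul, ← integral_const_mul, ← integral_sub,
    ← integral_sub]
  · refine integral_congr_ae (ae_of_all _ fun y => ?_)
    simp only [hK]; ring
  · exact (((scaledMoment_integrableOn ζ hα hμ1 hs).const_mul _).sub
      ((scaledMoment_integrableOn ζ hα hμ hs).const_mul _))
  · exact (scaledMoment_integrableOn ζ hα hμ2 hs).const_mul _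
  · exact (scaledMoment_integrableOn ζ hα hμ1 hs).const_mul _
  · exact (scaledMoment_integrableOn ζ hα hμ hs).const_mul _

lemma norm_jacobiExpKernel_le (α μ : ℂ) {s r y : ℝ} (hsr : r ≤ s) (hy : 0 ≤ y) :
    ‖jacobiExpKernel α μ s y‖ ≤ ‖jacobiExpKernel α μ r y‖ := by
  simp only [jacobiExpKernel, norm_mul, Complex.norm_exp]
  refine mul_le_mul_of_nonneg_left (Real.exp_le_exp.2 ?_) (by positivity)
  rw [Complex.neg_re, Complex.neg_re, Complex.ofReal_re, Complex.ofReal_re, neg_le_neg_iff]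
  exact mul_le_mul_of_nonneg_right hsr hy

lemma scaledMoment_hasDerivAt {α μ : ℂ} (ζ : ℂ) (hα : -1 < α.re) (hμ : -1 < μ.re) {s : ℝ}
    (hs : 0 < s) :
    HasDerivAt (scaledMoment α μ ζ) (-scaledMoment α (μ + 1) ζ s) s := by
  have hμ1 : -1 < (μ + 1).re := by simp; linarith
  have h := hasDerivAt_integral_of_dominated_loc_of_deriv_le
    (μ := volume.restrict (Set.Ioi (0 : ℝ))) (s := Set.Ioi (s / 2)) (x₀ := s)
    (F := fun r y => jumpFactor ζ y * jacobiExpKernel α μ r y)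
    (F' := fun r y => -(jumpFactor ζ y * jacobiExpKernel α (μ + 1) r y))
    -- The kernel decreases in `s`, so its value at `s / 2` dominates on a neighbourhood of `s`.
    (bound := fun y => ‖jumpFactor ζ y * jacobiExpKernel α (μ + 1) (s / 2) y‖)
    (Ioi_mem_nhds (by linarith))
    (by
      filter_upwards [Ioi_mem_nhds hs] with r hr
      exact (scaledMoment_integrableOn ζ hα hμ hr).aestronglyMeasurable)
    (scaledMoment_integrableOn ζ hα hμ hs)
    (scaledMoment_integrableOn ζ hα hμ1 hs).neg.aestronglyMeasurable
    (by
      refine (ae_restrict_mem measurableSet_Ioi).mono fun y hy r hr => ?_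
      rw [norm_neg, norm_mul, norm_mul]
      exact mul_le_mul_of_nonneg_left
        (norm_jacobiExpKernel_le _ _ (le_of_lt hr) (le_of_lt hy)) (norm_nonneg _))
    (scaledMoment_integrableOn ζ hα hμ1 (by linarith)).norm
    (by
      refine (ae_restrict_mem measurableSet_Ioi).mono fun y hy r hr => ?_
      have h3 : HasDerivAt (fun r : ℝ => Complex.exp (-(r * y : ℝ)))
          (Complex.exp (-(r * y : ℝ)) * (-(y : ℂ))) r := by
        refine HasDerivAt.cexp ?_
        have := (((hasDerivAt_id r).mul_const y).ofReal_comp).fun_neg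
        simpa using this
      refine ((h3.const_mul (((y - 1 : ℝ) : ℂ) ^ α * (y : ℂ) ^ μ)).const_mul
        (jumpFactor ζ y)).congr_deriv ?_
      rw [jacobiExpKernel_add_one hy, jacobiExpKernel]
      ring)
  refine h.2.congr_deriv ?_
  rw [integral_neg]; rfl

/-! ### Moments: scaling, recurrence and derivative in `t`. -/

/-- For negative `x` this rests on `t > 0`: the principal logarithm splits without a branch
correction. -/
lemma ofReal_mul_cpow {t : ℝ} (ht : 0 < t) (x : ℝ) (α : ℂ) :
    ((t * x : ℝ) : ℂ) ^ α = (t : ℂ) ^ α * (x : ℂ) ^ α := by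
  have htc : (t : ℂ) ≠ 0 := by exact_mod_cast ht.ne'
  rcases eq_or_ne x 0 with rfl | hx
  · rcases eq_or_ne α 0 with rfl | h
    · simp
    · simp [Complex.zero_cpow h]
  · have hxc : (x : ℂ) ≠ 0 := by exact_mod_cast hx
    rw [Complex.ofReal_mul, Complex.cpow_def_of_ne_zero (mul_ne_zero htc hxc),
      Complex.cpow_def_of_ne_zero htc, Complex.cpow_def_of_ne_zero hxc,
      Complex.log_ofReal_mul ht hxc, ← Complex.ofReal_log ht.le, ← Complex.exp_add]
    congr 1; ring

lemma weight_mul {α μ ζ : ℂ} {t y : ℝ} (ht : 0 < t) (hy : 0 < y) (k : ℕ) :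
    ((t * y : ℝ) : ℂ) ^ k * weight α μ ζ t (t * y)
      = (t : ℂ) ^ (α + μ + k) * (jumpFactor ζ y * jacobiExpKernel α (μ + k) t y) := by
  have htc : (t : ℂ) ≠ 0 := by exact_mod_cast ht.ne'
  have hyc : (y : ℂ) ≠ 0 := by exact_mod_cast hy.ne'
  have e : t * y - t = t * (y - 1) := by ring
  have hh : heaviside (t * (y - 1)) = heaviside (y - 1) := by
    simp [heaviside, mul_pos_iff_of_pos_left ht]
  rw [weight, e, hh, ofReal_mul_cpow ht, ofReal_mul_cpow ht, jacobiExpKernel, jumpFactor,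
    Complex.cpow_add _ _ hyc, Complex.cpow_add _ _ htc, Complex.cpow_add _ _ htc,
    Complex.cpow_natCast, Complex.cpow_natCast]
  push_cast
  ring

/-- The `k`-th moment of the weight. -/
def moment (α μ ζ : ℂ) (t : ℝ) (k : ℕ) : ℂ :=
  ∫ x in Set.Ioi (0 : ℝ), (x : ℂ) ^ k * weight α μ ζ t x

lemma moment_eq (α μ ζ : ℂ) {t : ℝ} (ht : 0 < t) (k : ℕ) :
    moment α μ ζ t k = (t : ℂ) ^ (α + μ + k + 1) * scaledMoment α (μ + k) ζ t := by
  have htc : (t : ℂ) ≠ 0 := by exact_mod_cast ht.ne'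
  have h := integral_comp_mul_left_Ioi (fun x : ℝ => (x : ℂ) ^ k * weight α μ ζ t x) 0 ht
  rw [mul_zero, setIntegral_congr_fun measurableSet_Ioi (fun y hy => weight_mul ht hy k),
    integral_const_mul] at h
  rw [Complex.cpow_add _ _ htc, Complex.cpow_one, mul_right_comm]
  unfold scaledMoment
  rw [h, moment, Complex.real_smul]
  push_cast
  field_simp

lemma moment_integrableOn {α μ : ℂ} (ζ : ℂ) (hα : -1 < α.re) (hμ : -1 < μ.re) {t : ℝ}
    (ht : 0 < t) (k : ℕ) :
    IntegrableOn (fun x : ℝ => (x : ℂ) ^ k * weight α μ ζ t x) (Set.Ioi 0) := by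
  have hμk : -1 < (μ + k).re := by
    have : (0 : ℝ) ≤ k := k.cast_nonneg
    simp; linarith
  have h := (integrableOn_Ioi_comp_mul_left_iff
    (fun x : ℝ => (x : ℂ) ^ k * weight α μ ζ t x) 0 ht).1 ?_
  · simpa using h
  · refine IntegrableOn.congr_fun ((scaledMoment_integrableOn ζ hα hμk ht).const_mul
      ((t : ℂ) ^ (α + μ + k))) (fun y hy => (weight_mul ht hy k).symm) measurableSet_Ioi

lemma moment_pearson {α μ : ℂ} (ζ : ℂ) (hα : -1 < α.re) (hμ : -1 < μ.re) {t : ℝ}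
    (ht : 0 < t) (k : ℕ) :
    (k + 2 + α + μ + t) * moment α μ ζ t (k + 1) - t * (k + 1 + μ) * moment α μ ζ t k
      - moment α μ ζ t (k + 2) = 0 := by
  have htc : (t : ℂ) ≠ 0 := by exact_mod_cast ht.ne'
  have hμk : -1 < (μ + k).re := by
    have : (0 : ℝ) ≤ k := k.cast_nonneg
    simp; linarith
  have h := scaledMoment_pearson ζ hα hμk ht
  rw [moment_eq _ _ _ ht, moment_eq _ _ _ ht, moment_eq _ _ _ ht]
  push_cast
  rw [show α + μ + (k + 2 : ℂ) + 1 = α + μ + k + 1 + 1 + 1 by ring,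
    show α + μ + (k + 1 : ℂ) + 1 = α + μ + k + 1 + 1 by ring,
    Complex.cpow_add (x := (t : ℂ)) (α + μ + k + 1 + 1) 1 htc,
    Complex.cpow_add (x := (t : ℂ)) (α + μ + k + 1) 1 htc, Complex.cpow_one,
    ← add_assoc μ, ← add_assoc μ]
  linear_combination (t : ℂ) ^ (α + μ + k + 1) * t * h

lemma moment_hasDerivAt {α μ : ℂ} (ζ : ℂ) (hα : -1 < α.re) (hμ : -1 < μ.re) {t : ℝ}
    (ht : 0 < t) (k : ℕ) :
    HasDerivAt (fun s => moment α μ ζ s k)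
      (((α + μ + k + 1) * moment α μ ζ t k - moment α μ ζ t (k + 1)) / t) t := by
  have htc : (t : ℂ) ≠ 0 := by exact_mod_cast ht.ne'
  have hμk : -1 < (μ + k).re := by
    have : (0 : ℝ) ≤ k := k.cast_nonneg
    simp; linarith
  -- The exponent can be zero, for instance when `α = μ = -1/2` and `k = 0`; the power rule used
  -- below excludes that case.
  have e : α + μ + k + 1 ≠ 0 ∨ α + μ + k + 1 = 0 := (eq_or_ne _ _).symm
  have h1 : HasDerivAt (fun s : ℝ => (s : ℂ) ^ (α + μ + k + 1))
      ((α + μ + k + 1) * (t : ℂ) ^ (α + μ + k + 1) / t) t := by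
    rcases e with e | e
    · refine (hasDerivAt_ofReal_cpow_const ht.ne' e).congr_deriv ?_
      rw [Complex.cpow_sub _ _ htc, Complex.cpow_one]
      ring
    · simpa [e] using hasDerivAt_const t (1 : ℂ)
  have h2 := h1.mul (scaledMoment_hasDerivAt ζ hα hμk ht)
  refine (h2.congr_of_eventuallyEq ?_).congr_deriv ?_
  · filter_upwards [Ioi_mem_nhds ht] with s hs
    exact moment_eq _ _ _ hs k
  · rw [moment_eq _ _ _ ht, moment_eq _ _ _ ht]
    push_cast
    rw [show α + μ + (k + 1 : ℂ) + 1 = α + μ + k + 1 + 1 by ring,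
      Complex.cpow_add (x := (t : ℂ)) (α + μ + k + 1) 1 htc, Complex.cpow_one, ← add_assoc μ]
    field_simp
    ring

/-! ### The moment functional and its Pearson relation. -/

/-- The linear functional on polynomials with prescribed moments. -/
def momentFunctional (m : ℕ → ℂ) : ℂ[X] →ₗ[ℂ] ℂ :=
  Polynomial.lsum fun k => LinearMap.mulRight ℂ (m k)

lemma momentFunctional_monomial (m : ℕ → ℂ) (k : ℕ) (c : ℂ) :
    momentFunctional m (monomial k c) = c * m k := by
  simp [momentFunctional, Polynomial.lsum_apply, Polynomial.sum_monomial_index]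

lemma momentFunctional_eq_sum (m : ℕ → ℂ) {f : ℂ[X]} {N : ℕ} (hf : f.natDegree ≤ N) :
    momentFunctional m f = ∑ i ∈ Finset.range (N + 1), f.coeff i * m i := by
  conv_lhs => rw [Polynomial.as_sum_range' f (N + 1) (by omega)]
  rw [map_sum]
  exact Finset.sum_congr rfl fun i _ => momentFunctional_monomial _ _ _

lemma linearMap_C_mul (L : ℂ[X] →ₗ[ℂ] ℂ) (c : ℂ) (f : ℂ[X]) : L (C c * f) = c * L f := by
  rw [← smul_eq_C_mul, map_smul, smul_eq_mul]

/-- Grouping `σ f'` around the Euler operator `X f'` keeps the exponent `k` and avoids a truncated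
`k - 1`. -/
lemma X_mul_derivative_monomial (k : ℕ) (c : ℂ) :
    X * derivative (monomial k c) = monomial k (c * k) := by
  rw [derivative_monomial]
  rcases k with _ | k
  · simp
  · simp [X_mul_monomial]

lemma bilin_weight_eq {α μ : ℂ} (ζ : ℂ) (hα : -1 < α.re) (hμ : -1 < μ.re) {t : ℝ}
    (ht : 0 < t) (f g : ℂ[X]) :
    bilin (weight α μ ζ t) f g = momentFunctional (moment α μ ζ t) (f * g) := by
  rw [momentFunctional_eq_sum _ le_rfl, bilin]
  have : ∀ x : ℝ, f.eval (x : ℂ) * g.eval (x : ℂ) * weight α μ ζ t x =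
      ∑ i ∈ Finset.range ((f * g).natDegree + 1),
        (f * g).coeff i * ((x : ℂ) ^ i * weight α μ ζ t x) := by
    intro x
    rw [← eval_mul, eval_eq_sum_range, Finset.sum_mul]
    exact Finset.sum_congr rfl fun i _ => by ring
  simp only [this]
  rw [integral_finsetSum _ fun i _ => (moment_integrableOn ζ hα hμ ht i).const_mul _]
  exact Finset.sum_congr rfl fun i _ => integral_const_mul _ _

/-- The Pearson equation `(σ w)' = τ w` for `σ = x (x - t)`, in terms of a functional. -/
def IsPearson (α μ t : ℂ) (L : ℂ[X] →ₗ[ℂ] ℂ) : Prop :=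
  ∀ f : ℂ[X], L (X * (X * derivative f) - C t * (X * derivative f)
    - X * (X * f) + C (2 + α + μ + t) * (X * f) - C (t * (1 + μ)) * f) = 0

lemma momentFunctional_isPearson {α μ : ℂ} (ζ : ℂ) (hα : -1 < α.re) (hμ : -1 < μ.re) {t : ℝ}
    (ht : 0 < t) : IsPearson α μ t (momentFunctional (moment α μ ζ t)) := by
  intro f
  induction f using Polynomial.induction_on' with
  | add f g hf hg =>
    rw [← add_zero (0 : ℂ)]
    nth_rewrite 1 [← hf]
    rw [← hg, ← map_add]
    congr 1
    simp only [derivative_add]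
    ring
  | monomial k c =>
    rw [X_mul_derivative_monomial]
    simp only [LinearMap.map_sub, LinearMap.map_add, linearMap_C_mul, X_mul_monomial,
      momentFunctional_monomial]
    have := moment_pearson ζ hα hμ ht k
    linear_combination c * this

/-! ### Algebra of monic orthogonal polynomials. -/

/-- The first monic orthogonal polynomials for `L`, their squared norms `h` and the coefficients
of their recurrence `Q_{k+1} = (X - b_k) Q_k - A_k Q_{k-1}`. -/
structure IsMonicOrthogonal (L : ℂ[X] →ₗ[ℂ] ℂ) (N : ℕ) (Q : ℕ → ℂ[X]) (h A b : ℕ → ℂ) :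
    Prop where
  monic : ∀ k ≤ N, (Q k).Monic
  natDegree_eq : ∀ k ≤ N, (Q k).natDegree = k
  orth : ∀ i ≤ N, ∀ j ≤ N, i ≠ j → L (Q i * Q j) = 0
  norm_eq : ∀ k ≤ N, L (Q k * Q k) = h k
  norm_ne : ∀ k ≤ N, h k ≠ 0
  A_zero : A 0 = 0
  norm_succ : ∀ k < N, h (k + 1) = A (k + 1) * h k
  recurrence : ∀ k < N, Q (k + 1) = (X - C (b k)) * Q k - C (A k) * Q (k - 1)

namespace IsMonicOrthogonal

variable {L : ℂ[X] →ₗ[ℂ] ℂ} {N : ℕ} {Q : ℕ → ℂ[X]} {h A b : ℕ → ℂ}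

lemma coeff_self (H : IsMonicOrthogonal L N Q h A b) {k : ℕ} (hk : k ≤ N) :
    (Q k).coeff k = 1 := by
  have := (H.monic k hk).coeff_natDegree
  rwa [H.natDegree_eq k hk] at this

lemma coeff_gt (H : IsMonicOrthogonal L N Q h A b) {k i : ℕ} (hk : k ≤ N) (hi : k < i) :
    (Q k).coeff i = 0 :=
  coeff_eq_zero_of_natDegree_lt (by rwa [H.natDegree_eq k hk])

lemma zero_eq (H : IsMonicOrthogonal L N Q h A b) : Q 0 = 1 :=
  (H.monic 0 N.zero_le).natDegree_eq_zero.1 (H.natDegree_eq 0 N.zero_le)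

lemma orth_lt (H : IsMonicOrthogonal L N Q h A b) {k : ℕ} (hk : k ≤ N) {g : ℂ[X]}
    (hg : ∀ i, k ≤ i → g.coeff i = 0) : L (Q k * g) = 0 := by
  -- Induction on the degree bound `d`: a multiple of `Q d` removes the top coefficient.
  have key : ∀ d ≤ k, ∀ g : ℂ[X], (∀ i, d ≤ i → g.coeff i = 0) → L (Q k * g) = 0 := by
    intro d
    induction d with
    | zero =>
      intro _ g hg
      have : g = 0 := by ext i; simp [hg i i.zero_le]
      simp [this]
    | succ d ih =>
      intro hd g hg
      have h1 := ih (by omega) (g - C (g.coeff d) * Q d) fun i hi => by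
        rw [coeff_sub, coeff_C_mul]
        rcases hi.eq_or_lt with rfl | hi
        · simp [H.coeff_self (show d ≤ N by omega)]
        · simp [H.coeff_gt (show d ≤ N by omega) hi, hg i hi]
      rw [mul_sub, map_sub, mul_left_comm, linearMap_C_mul, H.orth k hk d (by omega) (by omega),
        mul_zero, sub_zero] at h1
      exact h1
  exact key k le_rfl g hg

lemma orth_le (H : IsMonicOrthogonal L N Q h A b) {k : ℕ} (hk : k ≤ N) {g : ℂ[X]}
    (hg : ∀ i, k < i → g.coeff i = 0) : L (Q k * g) = h k * g.coeff k := by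
  have h1 := H.orth_lt hk (g := g - C (g.coeff k) * Q k) fun i hi => by
    rw [coeff_sub, coeff_C_mul]
    rcases hi.eq_or_lt with rfl | hi
    · simp [H.coeff_self hk]
    · simp [H.coeff_gt hk hi, hg i hi]
  rw [mul_sub, map_sub, mul_left_comm, linearMap_C_mul, H.norm_eq k hk] at h1
  linear_combination h1

lemma coeff_pred (H : IsMonicOrthogonal L N Q h A b) {k : ℕ} (hk : k + 1 ≤ N) :
    (Q (k + 1)).coeff k = -∑ i ∈ Finset.range (k + 1), b i := by
  induction k with
  | zero =>
    rw [H.recurrence 0 (by omega), H.A_zero, H.zero_eq]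
    simp
  | succ k ih =>
    rw [H.recurrence (k + 1) (by omega), Finset.sum_range_succ, neg_add, ← ih (by omega)]
    simp only [sub_mul, coeff_sub, coeff_X_mul, coeff_C_mul, H.coeff_self (show k + 1 ≤ N by omega),
      Nat.add_sub_cancel, H.coeff_gt (show k ≤ N by omega) (Nat.lt_succ_self k)]
    ring

/-- One degree beyond `orth_le`: subtracting a multiple of `Q (k + 1)` changes the coefficient at
`k` by its subleading coefficient, a sum of the `b i`. -/
lemma orth_le_succ (H : IsMonicOrthogonal L N Q h A b) {k : ℕ} (hk : k + 1 ≤ N) {g : ℂ[X]}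
    (hg : ∀ i, k + 1 < i → g.coeff i = 0) :
    L (Q k * g) = h k * (g.coeff k + g.coeff (k + 1) * ∑ i ∈ Finset.range (k + 1), b i) := by
  have h1 := H.orth_le (show k ≤ N by omega) (g := g - C (g.coeff (k + 1)) * Q (k + 1))
    fun i hi => by
      rw [coeff_sub, coeff_C_mul]
      rcases (Nat.succ_le_of_lt hi).eq_or_lt with rfl | hi
      · simp [H.coeff_self hk]
      · simp [H.coeff_gt hk hi, hg i hi]
  rw [mul_sub, map_sub, mul_left_comm, linearMap_C_mul,
    H.orth k (by omega) (k + 1) hk (by omega), coeff_sub, coeff_C_mul, H.coeff_pred hk] at h1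
  linear_combination h1

lemma eq_zero_of_orth (H : IsMonicOrthogonal L N Q h A b) {d : ℕ} (hd : d ≤ N) {R : ℂ[X]}
    (hR : ∀ i, d ≤ i → R.coeff i = 0) (ho : ∀ j < d, L (R * Q j) = 0) : R = 0 := by
  induction d with
  | zero => ext i; simp [hR i i.zero_le]
  | succ d ih =>
    refine ih (by omega) (fun i hi => ?_) fun j hj => ho j (by omega)
    rcases hi.eq_or_lt with rfl | hi
    · have h1 := H.orth_le (show d ≤ N by omega) (g := R) fun i hi => hR i hi
      rw [mul_comm, ho d (by omega)] at h1
      exact (mul_eq_zero.1 h1.symm).resolve_left (H.norm_ne d (by omega))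
    · exact hR i hi

lemma X_mul_mul_pred (H : IsMonicOrthogonal L N Q h A b) {k : ℕ} (hk : k + 1 ≤ N) :
    L (Q (k + 1) * (X * Q k)) = h (k + 1) := by
  rw [H.orth_le hk, coeff_X_mul, H.coeff_self (by omega), mul_one]
  intro i hi
  obtain ⟨i, rfl⟩ : ∃ j, i = j + 1 := ⟨i - 1, by omega⟩
  rw [coeff_X_mul, H.coeff_gt (by omega) (by omega)]

/-- The factor `A k` is kept because at `k = 0` the index `k - 1` truncates to `0`, and `A 0 = 0`
removes the spurious term. -/
lemma A_mul_X_mul_pred (H : IsMonicOrthogonal L N Q h A b) {k : ℕ} (hk : k ≤ N) :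
    A k * L (Q k * (X * Q (k - 1))) = A k * h k := by
  rcases k with _ | k
  · simp [H.A_zero]
  · rw [Nat.add_sub_cancel, H.X_mul_mul_pred hk]

lemma A_mul_orth_pred (H : IsMonicOrthogonal L N Q h A b) {k : ℕ} (hk : k ≤ N) :
    A k * L (Q k * Q (k - 1)) = 0 := by
  rcases k with _ | k
  · simp [H.A_zero]
  · rw [Nat.add_sub_cancel, H.orth _ hk _ (by omega) (by omega), mul_zero]

lemma X_mul_eq (H : IsMonicOrthogonal L N Q h A b) {k : ℕ} (hk : k + 1 ≤ N) :
    X * Q k = Q (k + 1) + C (b k) * Q k + C (A k) * Q (k - 1) := by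
  rw [H.recurrence k (by omega)]; ring

lemma X_mul_self (H : IsMonicOrthogonal L N Q h A b) {k : ℕ} (hk : k + 1 ≤ N) :
    L (Q k * (X * Q k)) = b k * h k := by
  rw [H.X_mul_eq hk, mul_add, mul_add, map_add, map_add, mul_left_comm, mul_left_comm (Q k),
    linearMap_C_mul, linearMap_C_mul, H.norm_eq k (by omega), H.A_mul_orth_pred (by omega),
    H.orth k (by omega) (k + 1) hk (by omega)]
  ring

lemma X_sq_mul_self (H : IsMonicOrthogonal L N Q h A b) {k : ℕ} (hk : k + 1 ≤ N) :
    L (Q k * (X * (X * Q k))) = (A (k + 1) + b k ^ 2 + A k) * h k := by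
  have e : Q k * (X * (X * Q k)) = Q (k + 1) * (X * Q k) + C (b k) * (Q k * (X * Q k))
      + C (A k) * (Q k * (X * Q (k - 1))) := by
    linear_combination Q k * X * H.X_mul_eq hk
  rw [e, map_add, map_add, linearMap_C_mul, linearMap_C_mul, H.X_mul_mul_pred hk,
    H.X_mul_self hk, H.A_mul_X_mul_pred (by omega), H.norm_succ k (by omega)]
  ring

/-- A common zero of neighbours would descend through the recurrence to `Q 0 = 1`, since nonzero
norms force `A (k + 1) ≠ 0`. -/
lemma eval_ne_zero (H : IsMonicOrthogonal L N Q h A b) {k : ℕ} (hk : k + 1 ≤ N) (x : ℂ) :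
    (Q (k + 1)).eval x ≠ 0 ∨ (Q k).eval x ≠ 0 := by
  induction k with
  | zero => right; simp [H.zero_eq]
  | succ k ih =>
    by_contra! hc
    have hr := congrArg (eval x) (H.recurrence (k + 1) (by omega))
    simp only [hc.1, hc.2, eval_sub, eval_mul, eval_X, eval_C, Nat.add_sub_cancel, mul_zero,
      zero_sub, zero_eq_neg, mul_eq_zero] at hr
    rcases ih (by omega) with h1 | h1
    · exact h1 hc.2
    · have h2 := H.norm_succ k (by omega)
      rw [hr.resolve_right h1, zero_mul] at h2
      exact H.norm_ne (k + 1) (by omega) h2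

end IsMonicOrthogonal

/-! ### Structure relation and Laguerre–Freud equations. -/

lemma coeff_X_mul_derivative (g : ℂ[X]) (m : ℕ) :
    (X * derivative g).coeff m = m * g.coeff m := by
  rcases m with _ | m
  · simp
  · rw [coeff_X_mul, coeff_derivative]; push_cast; ring

namespace IsMonicOrthogonal

variable {L : ℂ[X] →ₗ[ℂ] ℂ} {N : ℕ} {Q : ℕ → ℂ[X]} {h A b : ℕ → ℂ} {α μ t : ℂ}

lemma orth_sigma_derivative (H : IsMonicOrthogonal L N Q h A b) (hL : IsPearson α μ t L) {m : ℕ}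
    (hm : m + 2 ≤ N) {g : ℂ[X]} (hg : ∀ i, m < i → g.coeff i = 0) :
    L (X * (X * derivative (Q (m + 1))) * g - C t * (X * derivative (Q (m + 1))) * g)
      = h (m + 1) * (g.coeff m * (∑ i ∈ Finset.range (m + 2), b i - m - 2 - α - μ - t)
        + (X * g).coeff m) := by
  have h1 := hL (Q (m + 1) * g)
  -- `G = σ g' + τ g` has degree at most `m + 2`, so pairing it with `Q (m + 1)` involves only its
  -- two top coefficients.
  set G : ℂ[X] := X * (X * derivative g) - C t * (X * derivative g) - X * (X * g)
    + C (2 + α + μ + t) * (X * g) - C (t * (1 + μ)) * g with hG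
  have e : X * (X * derivative (Q (m + 1) * g)) - C t * (X * derivative (Q (m + 1) * g))
      - X * (X * (Q (m + 1) * g)) + C (2 + α + μ + t) * (X * (Q (m + 1) * g))
      - C (t * (1 + μ)) * (Q (m + 1) * g)
      = (X * (X * derivative (Q (m + 1))) * g - C t * (X * derivative (Q (m + 1))) * g)
        + Q (m + 1) * G := by
    rw [hG, derivative_mul]; ring
  rw [e, map_add] at h1
  have hg1 : g.coeff (m + 1) = 0 := hg _ (by omega)
  have h2 := H.orth_le_succ (show m + 1 + 1 ≤ N by omega) (g := G) fun i hi => by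
    obtain ⟨i, rfl⟩ : ∃ j, i = j + 2 := ⟨i - 2, by omega⟩
    simp only [hG, coeff_sub, coeff_add, coeff_C_mul, coeff_X_mul]
    simp [hg i (by omega), hg (i + 1) (by omega), hg (i + 2) (by omega), coeff_derivative]
  have c1 : G.coeff (m + 1) = m * g.coeff m - (X * g).coeff m + (2 + α + μ + t) * g.coeff m := by
    simp only [hG, coeff_sub, coeff_add, coeff_C_mul, coeff_X_mul, coeff_X_mul_derivative, hg1]
    simp [coeff_derivative, hg1]
  have c2 : G.coeff (m + 1 + 1) = -g.coeff m := by
    simp only [hG, coeff_sub, coeff_add, coeff_C_mul, coeff_X_mul, hg1]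
    simp [coeff_derivative, hg1, hg (m + 2) (by omega)]
  rw [c1, c2] at h2
  linear_combination h1 - h2

/-- The lowering (structure) relation of semi-classical Laguerre polynomials. -/
lemma structure_relation (H : IsMonicOrthogonal L N Q h A b) (hL : IsPearson α μ t L) {n : ℕ}
    (hn : n + 1 ≤ N) :
    X * (X * derivative (Q n)) - C t * (X * derivative (Q n))
      = C (n : ℂ) * (X * Q n) + C (∑ i ∈ Finset.range n, b i - n * t - A n) * Q n
        + C (A n) * (X * Q (n - 1) + C (b n - 2 * n - 1 - α - μ - t) * Q (n - 1)) := by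
  rcases n with _ | m
  · simp [H.zero_eq, H.A_zero]
  rw [← sub_eq_zero, Nat.add_sub_cancel]
  -- The difference of the two sides loses its coefficients in degrees `m + 2` and `m + 1`, and it
  -- is orthogonal to every `Q j` with `j ≤ m`.
  refine H.eq_zero_of_orth (d := m + 1) (by omega) (fun i hi => ?_) fun j hj => ?_
  · have k1 := H.coeff_pred (show m + 1 ≤ N by omega)
    have k2 := H.coeff_self (show m + 1 ≤ N by omega)
    have k3 := H.coeff_self (show m ≤ N by omega)
    have k4 := fun i => H.coeff_gt (i := i) (show m + 1 ≤ N by omega)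
    have k5 := fun i => H.coeff_gt (i := i) (show m ≤ N by omega)
    obtain ⟨i, rfl⟩ : ∃ j, i = j + 1 := ⟨i - 1, by omega⟩
    simp only [coeff_sub, coeff_add, coeff_C_mul, coeff_X_mul, coeff_X_mul_derivative]
    rcases (show m ≤ i by omega).eq_or_lt with rfl | hi
    · rw [k1, k2, k3, k5 _ (by omega), coeff_derivative, k2]
      push_cast; ring
    · rw [k5 _ hi, k5 _ (show m < i + 1 by omega), k4 _ (show m + 1 < i + 1 by omega),
        coeff_derivative, k4 _ (show m + 1 < i + 1 by omega)]
      rcases (Nat.succ_le_of_lt hi).eq_or_lt with rfl | hi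
      · rw [k2]; push_cast; ring
      · rw [k4 _ hi]; ring
  · have hg : ∀ i, m < i → (Q j).coeff i = 0 := fun i hi => H.coeff_gt (by omega) (by omega)
    have e : ∀ c θ : ℂ, (X * (X * derivative (Q (m + 1))) - C t * (X * derivative (Q (m + 1)))
        - (C ((m + 1 : ℕ) : ℂ) * (X * Q (m + 1)) + C c * Q (m + 1)
          + C (A (m + 1)) * (X * Q m + C θ * Q m))) * Q j
        = (X * (X * derivative (Q (m + 1))) * Q j - C t * (X * derivative (Q (m + 1))) * Q j)
          - C ((m + 1 : ℕ) : ℂ) * (Q (m + 1) * (X * Q j)) - C c * (Q (m + 1) * Q j)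
          - C (A (m + 1)) * (Q m * (X * Q j + C θ * Q j)) := fun c θ => by ring
    rw [e, map_sub, map_sub, map_sub, linearMap_C_mul, linearMap_C_mul, linearMap_C_mul,
      H.orth_sigma_derivative hL (by omega) hg,
      H.orth (m + 1) (by omega) j (by omega) (by omega)]
    rw [H.orth_le (k := m + 1) (by omega) (g := X * Q j) fun i hi => by
        obtain ⟨i, rfl⟩ : ∃ j, i = j + 1 := ⟨i - 1, by omega⟩
        rw [coeff_X_mul, hg _ (by omega)],
      H.orth_le_succ (k := m) (by omega) fun i hi => by
        obtain ⟨i, rfl⟩ : ∃ j, i = j + 1 := ⟨i - 1, by omega⟩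
        rw [coeff_add, coeff_X_mul, coeff_C_mul, hg _ (by omega), hg _ (by omega)]; ring]
    simp only [coeff_add, coeff_X_mul, coeff_C_mul, hg (m + 1) (by omega)]
    rw [Finset.sum_range_succ _ (m + 1), H.norm_succ m (by omega)]
    push_cast; ring

/-- The first Laguerre–Freud equation, from the Pearson equation applied to `Q_n²`. -/
lemma laguerre_freud (H : IsMonicOrthogonal L N Q h A b) (hL : IsPearson α μ t L) {n : ℕ}
    (hn : n + 1 ≤ N) :
    2 * ∑ i ∈ Finset.range n, b i - 2 * n * t - t * (1 + μ)
      + (2 * n + 2 + α + μ + t - b n) * b n = A n + A (n + 1) := by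
  have h1 := hL (Q n * Q n)
  have e : X * (X * derivative (Q n * Q n)) - C t * (X * derivative (Q n * Q n))
      - X * (X * (Q n * Q n)) + C (2 + α + μ + t) * (X * (Q n * Q n))
      - C (t * (1 + μ)) * (Q n * Q n)
      = C 2 * ((X * (X * derivative (Q n)) - C t * (X * derivative (Q n))) * Q n)
        - Q n * (X * (X * Q n)) + C (2 + α + μ + t) * (Q n * (X * Q n))
        - C (t * (1 + μ)) * (Q n * Q n) := by
    rw [derivative_mul, show (C 2 : ℂ[X]) = 2 from rfl]; ring
  have e2 : ∀ c θ : ℂ, (C (n : ℂ) * (X * Q n) + C c * Q n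
      + C (A n) * (X * Q (n - 1) + C θ * Q (n - 1))) * Q n
      = C (n : ℂ) * (Q n * (X * Q n)) + C c * (Q n * Q n)
        + C (A n) * (Q n * (X * Q (n - 1))) + C θ * (C (A n) * (Q n * Q (n - 1))) :=
    fun c θ => by ring
  rw [e, H.structure_relation hL hn, e2] at h1
  simp only [LinearMap.map_add, LinearMap.map_sub, linearMap_C_mul] at h1
  rw [H.A_mul_X_mul_pred (by omega), H.A_mul_orth_pred (by omega), H.X_mul_self hn,
    H.X_sq_mul_self hn, H.norm_eq n (by omega)] at h1
  have h0 := H.norm_ne n (by omega)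
  apply mul_left_cancel₀ h0
  linear_combination h1

/-- At a zero of `σ` the structure relations for `m + 1` and `m`, with `Q (m - 1)` eliminated by the
recurrence, are two homogeneous linear equations in `(Q (m + 1), Q m)`. By `eval_ne_zero` this
vector is nonzero. -/
lemma det_eq_zero (H : IsMonicOrthogonal L N Q h A b) (hL : IsPearson α μ t L) {m : ℕ}
    (hm : m + 2 ≤ N) {x : ℂ} (hx : x * (x - t) = 0) :
    ((m + 1) * x + ∑ i ∈ Finset.range (m + 1), b i - (m + 1) * t - A (m + 1))
      * (m * x + ∑ i ∈ Finset.range m, b i - m * t - A m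
        + (x + (b m - 2 * m - 1 - α - μ - t)) * (x - b m))
      + A (m + 1) * (x + (b (m + 1) - 2 * (m + 1) - 1 - α - μ - t))
        * (x + (b m - 2 * m - 1 - α - μ - t)) = 0 := by
  have h1 := congrArg (eval x) (H.structure_relation hL (n := m + 1) (by omega))
  have h2 := congrArg (eval x) (H.structure_relation hL (n := m) (by omega))
  have h3 := congrArg (eval x) (H.recurrence m (by omega))
  simp only [eval_add, eval_sub, eval_mul, eval_X, eval_C, Nat.add_sub_cancel] at h1 h2 h3
  push_cast at h1
  set u := eval x (Q (m + 1))
  set v := eval x (Q m)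
  have g1 : ((m + 1) * x + ∑ i ∈ Finset.range (m + 1), b i - (m + 1) * t - A (m + 1)) * u
      + A (m + 1) * (x + (b (m + 1) - 2 * (m + 1) - 1 - α - μ - t)) * v = 0 := by
    linear_combination eval x (derivative (Q (m + 1))) * hx - h1
  have g2 : (m * x + ∑ i ∈ Finset.range m, b i - m * t - A m
      + (x + (b m - 2 * m - 1 - α - μ - t)) * (x - b m)) * v
      - (x + (b m - 2 * m - 1 - α - μ - t)) * u = 0 := by
    linear_combination eval x (derivative (Q m)) * hx - h2
      - (x + (b m - 2 * m - 1 - α - μ - t)) * h3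
  rcases H.eval_ne_zero (k := m) (by omega) x with h0 | h0
  · refine (mul_eq_zero.1 ?_).resolve_left h0
    linear_combination (m * x + ∑ i ∈ Finset.range m, b i - m * t - A m
      + (x + (b m - 2 * m - 1 - α - μ - t)) * (x - b m)) * g1
      - A (m + 1) * (x + (b (m + 1) - 2 * (m + 1) - 1 - α - μ - t)) * g2
  · refine (mul_eq_zero.1 ?_).resolve_left h0
    linear_combination ((m + 1) * x + ∑ i ∈ Finset.range (m + 1), b i - (m + 1) * t - A (m + 1))
      * g2 + (x + (b m - 2 * m - 1 - α - μ - t)) * g1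

end IsMonicOrthogonal

/-! ### Differentiation in `t` of polynomials and pairings. -/

/-- Coefficientwise differentiability of a polynomial of locally bounded degree. -/
def PolyHasDerivAt (Q : ℝ → ℂ[X]) (Q' : ℂ[X]) (t : ℝ) : Prop :=
  ∃ N, (∀ᶠ s in 𝓝 t, (Q s).natDegree ≤ N) ∧ Q'.natDegree ≤ N ∧
    ∀ i, HasDerivAt (fun s => (Q s).coeff i) (Q'.coeff i) t

namespace PolyHasDerivAt

variable {Q R : ℝ → ℂ[X]} {Q' R' : ℂ[X]} {t : ℝ}

lemma congr (hQ : PolyHasDerivAt Q Q' t) (h : R =ᶠ[𝓝 t] Q) : PolyHasDerivAt R Q' t := by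
  obtain ⟨N, h1, h2, h3⟩ := hQ
  refine ⟨N, ?_, h2, fun i => (h3 i).congr_of_eventuallyEq ?_⟩
  · filter_upwards [h, h1] with s hs hs1
    rwa [hs]
  · filter_upwards [h] with s hs
    rw [hs]

lemma const (F : ℂ[X]) (t : ℝ) : PolyHasDerivAt (fun _ => F) 0 t :=
  ⟨F.natDegree, by simp, by simp, fun i => by simpa using hasDerivAt_const t (F.coeff i)⟩

lemma C {c : ℝ → ℂ} {c' : ℂ} (hc : HasDerivAt c c' t) :
    PolyHasDerivAt (fun s => Polynomial.C (c s)) (Polynomial.C c') t := by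
  refine ⟨0, by simp, by simp, fun i => ?_⟩
  rcases i with _ | i
  · simpa using hc
  · simpa [coeff_C_succ] using hasDerivAt_const t (0 : ℂ)

lemma sub (hQ : PolyHasDerivAt Q Q' t) (hR : PolyHasDerivAt R R' t) :
    PolyHasDerivAt (fun s => Q s - R s) (Q' - R') t := by
  obtain ⟨N, h1, h2, h3⟩ := hQ
  obtain ⟨M, k1, k2, k3⟩ := hR
  refine ⟨max N M, ?_, (natDegree_sub_le _ _).trans (max_le_max h2 k2), fun i => ?_⟩
  · filter_upwards [h1, k1] with s hs hs'
    exact (natDegree_sub_le _ _).trans (max_le_max hs hs')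
  · simpa using (h3 i).fun_sub (k3 i)

lemma mul (hQ : PolyHasDerivAt Q Q' t) (hR : PolyHasDerivAt R R' t) :
    PolyHasDerivAt (fun s => Q s * R s) (Q' * R t + Q t * R') t := by
  obtain ⟨N, h1, h2, h3⟩ := hQ
  obtain ⟨M, k1, k2, k3⟩ := hR
  refine ⟨N + M, ?_, ?_, fun i => ?_⟩
  · filter_upwards [h1, k1] with s hs hs'
    exact natDegree_mul_le.trans (add_le_add hs hs')
  · exact natDegree_add_le_of_degree_le
      (natDegree_mul_le.trans (add_le_add h2 k1.self_of_nhds))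
      (natDegree_mul_le.trans (add_le_add h1.self_of_nhds k2))
  · simp only [coeff_mul, coeff_add]
    rw [← Finset.sum_add_distrib]
    exact HasDerivAt.fun_sum fun p _ => (h3 p.1).fun_mul (k3 p.2)

/-- The local degree bound makes the pairing a fixed finite sum near `t`, to which the product rule
applies. -/
lemma momentFunctional {m : ℝ → ℕ → ℂ} {m' : ℕ → ℂ} (hQ : PolyHasDerivAt Q Q' t)
    (hm : ∀ k, HasDerivAt (fun s => m s k) (m' k) t) :
    HasDerivAt (fun s => LaguerrePV.momentFunctional (m s) (Q s))
      (LaguerrePV.momentFunctional m' (Q t) + LaguerrePV.momentFunctional (m t) Q') t := by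
  obtain ⟨N, h1, h2, h3⟩ := hQ
  rw [momentFunctional_eq_sum _ h1.self_of_nhds, momentFunctional_eq_sum _ h2,
    ← Finset.sum_add_distrib]
  refine (HasDerivAt.fun_sum (u := Finset.range (N + 1))
    fun i _ => (h3 i).fun_mul (hm i)).congr_of_eventuallyEq ?_ |>.congr_deriv ?_
  · filter_upwards [h1] with s hs
    rw [momentFunctional_eq_sum _ hs]
  · exact Finset.sum_congr rfl fun i _ => by ring

end PolyHasDerivAt

/-- The derivative of the moments with respect to the position of the singularity. -/
def momentDeriv (c : ℂ) (t : ℝ) (m : ℕ → ℂ) (k : ℕ) : ℂ := ((c + k + 1) * m k - m (k + 1)) / t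

/-- In operator form: `t L'` is `L` composed with `x d/dx + c + 1 - x`. -/
lemma momentFunctional_momentDeriv (c : ℂ) {t : ℝ} (ht : t ≠ 0) (m : ℕ → ℂ) (f : ℂ[X]) :
    t * momentFunctional (momentDeriv c t m) f = momentFunctional m (X * derivative f)
      + (c + 1) * momentFunctional m f - momentFunctional m (X * f) := by
  have htc : (t : ℂ) ≠ 0 := by exact_mod_cast ht
  induction f using Polynomial.induction_on' with
  | add f g hf hg =>
    simp only [mul_add, LinearMap.map_add]
    linear_combination hf + hg
  | monomial k a =>
    rw [X_mul_derivative_monomial]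
    simp only [X_mul_monomial, momentFunctional_monomial, momentDeriv]
    field_simp
    ring

/-! ### Toda-type deformation equations. -/

/-- Monic orthogonal polynomials for functionals `L_t` whose moments satisfy
`t m_k' = (c + k + 1) m_k - m_{k+1}`. -/
structure IsDeformation (c : ℂ) (U : Set ℝ) (m : ℝ → ℕ → ℂ) (N : ℕ) (Q : ℝ → ℕ → ℂ[X])
    (h A b : ℝ → ℕ → ℂ) : Prop where
  isOpen : IsOpen U
  ne_zero : ∀ t ∈ U, t ≠ 0
  moment_deriv : ∀ t ∈ U, ∀ k, HasDerivAt (fun s => m s k) (momentDeriv c t (m t) k) t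
  orthogonal : ∀ t ∈ U, IsMonicOrthogonal (momentFunctional (m t)) N (Q t) (h t) (A t) (b t)

namespace IsDeformation

variable {c : ℂ} {U : Set ℝ} {m : ℝ → ℕ → ℂ} {N : ℕ} {Q : ℝ → ℕ → ℂ[X]} {h A b : ℝ → ℕ → ℂ}
  {t : ℝ}

lemma norm_hasDerivAt_aux (D : IsDeformation c U m N Q h A b) (ht : t ∈ U) {k : ℕ} (hk : k ≤ N)
    {Q' : ℂ[X]} (hQ : PolyHasDerivAt (fun s => Q s k) Q' t) :
    HasDerivAt (fun s => h s k) (momentFunctional (momentDeriv c t (m t)) (Q t k * Q t k)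
      + momentFunctional (m t) (Q' * Q t k + Q t k * Q')) t := by
  refine ((hQ.mul hQ).momentFunctional (D.moment_deriv t ht)).congr_of_eventuallyEq ?_
  filter_upwards [D.isOpen.mem_nhds ht] with s hs
  exact ((D.orthogonal s hs).norm_eq k hk).symm

/-- Smoothness in `t` is derived from the moments: `b k = L(Q_k X Q_k) / h k` and `A k = h k / h (k
- 1)` are quotients of differentiable functions, and the recurrence passes this on to `Q (k + 1)`.
-/
lemma exists_polyHasDerivAt (D : IsDeformation c U m N Q h A b) (ht : t ∈ U) {k : ℕ}
    (hk : k ≤ N) : ∃ Q', PolyHasDerivAt (fun s => Q s k) Q' t := by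
  have hU := D.isOpen.mem_nhds ht
  induction k using Nat.strong_induction_on with
  | _ k ih =>
    rcases k with _ | k
    · refine ⟨0, (PolyHasDerivAt.const 1 t).congr ?_⟩
      filter_upwards [hU] with s hs
      exact (D.orthogonal s hs).zero_eq
    · obtain ⟨Qk, hQk⟩ := ih k (by omega) (by omega)
      obtain ⟨Qp, hQp⟩ := ih (k - 1) (by omega) (by omega)
      have hh := D.norm_hasDerivAt_aux ht (by omega) hQk
      have h0 := (D.orthogonal t ht).norm_ne k (by omega)
      have hb : DifferentiableAt ℝ (fun s => b s k) t := by
        have h1 := ((hQk.mul ((PolyHasDerivAt.const X t).mul hQk)).momentFunctional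
          (D.moment_deriv t ht)).differentiableAt
        refine (h1.fun_div hh.differentiableAt h0).congr_of_eventuallyEq ?_
        filter_upwards [hU] with s hs
        rw [(D.orthogonal s hs).X_mul_self hk,
          mul_div_cancel_right₀ _ ((D.orthogonal s hs).norm_ne k (by omega))]
      have hA : DifferentiableAt ℝ (fun s => A s k) t := by
        rcases k with _ | k
        · refine (differentiableAt_const (0 : ℂ)).congr_of_eventuallyEq ?_
          filter_upwards [hU] with s hs
          exact (D.orthogonal s hs).A_zero
        · have h2 := D.norm_hasDerivAt_aux ht (by omega) hQp
          refine (hh.differentiableAt.fun_div h2.differentiableAt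
            ((D.orthogonal t ht).norm_ne _ (by omega))).congr_of_eventuallyEq ?_
          filter_upwards [hU] with s hs
          rw [(D.orthogonal s hs).norm_succ k (by omega), Nat.add_sub_cancel,
            mul_div_cancel_right₀ _ ((D.orthogonal s hs).norm_ne k (by omega))]
      refine ⟨_, ((((PolyHasDerivAt.const X t).sub (PolyHasDerivAt.C hb.hasDerivAt)).mul hQk).sub
        ((PolyHasDerivAt.C hA.hasDerivAt).mul hQp)).congr ?_⟩
      filter_upwards [hU] with s hs
      exact (D.orthogonal s hs).recurrence k (by omega)

/-- Monicity fixes the leading coefficient, so the `t`-derivative of `Q k` has lower degree and is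
orthogonal to `Q k`. -/
lemma coeff_deriv_eq_zero (D : IsDeformation c U m N Q h A b) (ht : t ∈ U) {k : ℕ} (hk : k ≤ N)
    {Q' : ℂ[X]} (hQ : PolyHasDerivAt (fun s => Q s k) Q' t) {i : ℕ} (hi : k ≤ i) :
    Q'.coeff i = 0 := by
  obtain ⟨_, _, _, h3⟩ := hQ
  refine (h3 i).unique ((hasDerivAt_const t ((Q t k).coeff i)).congr_of_eventuallyEq ?_)
  filter_upwards [D.isOpen.mem_nhds ht] with s hs
  rcases hi.eq_or_lt with rfl | hi
  · rw [(D.orthogonal s hs).coeff_self hk, (D.orthogonal t ht).coeff_self hk]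
  · rw [(D.orthogonal s hs).coeff_gt hk hi, (D.orthogonal t ht).coeff_gt hk hi]

lemma norm_hasDerivAt (D : IsDeformation c U m N Q h A b) (ht : t ∈ U) {k : ℕ} (hk : k + 1 ≤ N) :
    HasDerivAt (fun s => h s k) ((2 * k + 1 + c - b t k) * h t k / t) t := by
  have htc : (t : ℂ) ≠ 0 := by exact_mod_cast D.ne_zero t ht
  have H := D.orthogonal t ht
  obtain ⟨Q', hQ⟩ := D.exists_polyHasDerivAt ht (show k ≤ N by omega)
  refine (D.norm_hasDerivAt_aux ht (by omega) hQ).congr_deriv ?_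
  have h1 := H.orth_lt (show k ≤ N by omega) fun i hi => D.coeff_deriv_eq_zero ht (by omega) hQ hi
  rw [LinearMap.map_add, mul_comm Q', h1, add_zero, add_zero, eq_div_iff htc, mul_comm,
    momentFunctional_momentDeriv c (D.ne_zero t ht), H.norm_eq k (by omega)]
  have e1 : X * derivative (Q t k * Q t k) = C 2 * (Q t k * (X * derivative (Q t k))) := by
    rw [derivative_mul, show (C 2 : ℂ[X]) = 2 from rfl]; ring
  have e2 : X * (Q t k * Q t k) = Q t k * (X * Q t k) := by ring
  rw [e1, e2, linearMap_C_mul, H.X_mul_self hk, H.orth_le (by omega), coeff_X_mul_derivative,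
    H.coeff_self (by omega)]
  · ring
  · intro i hi
    rw [coeff_X_mul_derivative, H.coeff_gt (by omega) hi, mul_zero]

/-- The sum is minus the subleading coefficient of `Q k`; its derivative is read off by
differentiating `L(Q_k Q_{k-1}) = 0`. -/
lemma sum_hasDerivAt (D : IsDeformation c U m N Q h A b) (ht : t ∈ U) {k : ℕ} (hk : k ≤ N) :
    HasDerivAt (fun s => ∑ i ∈ Finset.range k, b s i)
      ((∑ i ∈ Finset.range k, b t i - A t k) / t) t := by
  have htc : (t : ℂ) ≠ 0 := by exact_mod_cast D.ne_zero t ht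
  have H := D.orthogonal t ht
  have hU := D.isOpen.mem_nhds ht
  rcases k with _ | k
  · simpa [H.A_zero] using hasDerivAt_const t (0 : ℂ)
  obtain ⟨Q', hQ⟩ := D.exists_polyHasDerivAt ht hk
  obtain ⟨R', hR⟩ := D.exists_polyHasDerivAt ht (show k ≤ N by omega)
  have h1 := (hQ.mul hR).momentFunctional (D.moment_deriv t ht)
  have h2 := h1.unique ((hasDerivAt_const t (0 : ℂ)).congr_of_eventuallyEq (by
    filter_upwards [hU] with s hs
    exact (D.orthogonal s hs).orth _ hk _ (by omega) (by omega)))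
  have z1 := H.orth_lt hk (g := R') fun i hi =>
    D.coeff_deriv_eq_zero ht (by omega) hR (by omega)
  have z2 := H.orth_le (show k ≤ N by omega) (g := Q') fun i hi =>
    D.coeff_deriv_eq_zero ht hk hQ (by omega)
  have z3 := momentFunctional_momentDeriv c (D.ne_zero t ht) (m t) (Q t (k + 1) * Q t k)
  have e1 : X * derivative (Q t (k + 1) * Q t k)
      = Q t k * (X * derivative (Q t (k + 1))) + Q t (k + 1) * (X * derivative (Q t k)) := by
    rw [derivative_mul]; ring
  have z4 := H.orth_le_succ hk (g := X * derivative (Q t (k + 1))) fun i hi => by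
    rw [coeff_X_mul_derivative, H.coeff_gt hk hi, mul_zero]
  have z5 := H.orth_lt hk (g := X * derivative (Q t k)) fun i hi => by
    rw [coeff_X_mul_derivative, H.coeff_gt (by omega) (by omega), mul_zero]
  rw [e1, LinearMap.map_add, z4, z5, H.orth _ hk _ (by omega) (by omega), mul_left_comm,
    H.X_mul_mul_pred hk, H.norm_succ k (by omega), coeff_X_mul_derivative,
    coeff_X_mul_derivative, H.coeff_pred hk, H.coeff_self hk] at z3
  rw [LinearMap.map_add, mul_comm Q', z1, z2] at h2
  obtain ⟨_, _, _, h3⟩ := hQ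
  refine ((h3 k).fun_neg.congr_of_eventuallyEq ?_).congr_deriv ?_
  · filter_upwards [hU] with s hs
    rw [(D.orthogonal s hs).coeff_pred hk, neg_neg]
  · rw [eq_div_iff htc]
    apply mul_left_cancel₀ (H.norm_ne k (by omega))
    push_cast at z3
    linear_combination z3 - (t : ℂ) * h2

lemma b_hasDerivAt (D : IsDeformation c U m N Q h A b) (ht : t ∈ U) {k : ℕ} (hk : k + 1 ≤ N) :
    HasDerivAt (fun s => b s k) ((b t k - A t (k + 1) + A t k) / t) t := by
  refine (((D.sum_hasDerivAt ht hk).fun_sub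
    (D.sum_hasDerivAt ht (show k ≤ N by omega))).congr_deriv ?_).congr_of_eventuallyEq ?_
  · rw [Finset.sum_range_succ]; ring
  · refine Eventually.of_forall fun s => ?_
    simp only [Finset.sum_range_succ]; ring

lemma A_hasDerivAt (D : IsDeformation c U m N Q h A b) (ht : t ∈ U) {k : ℕ} (hk : k + 1 ≤ N) :
    HasDerivAt (fun s => A s k) (A t k * (2 + b t (k - 1) - b t k) / t) t := by
  have htc : (t : ℂ) ≠ 0 := by exact_mod_cast D.ne_zero t ht
  have hU := D.isOpen.mem_nhds ht
  have H := D.orthogonal t ht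
  rcases k with _ | k
  · refine ((hasDerivAt_const t (0 : ℂ)).congr_of_eventuallyEq ?_).congr_deriv ?_
    · filter_upwards [hU] with s hs
      exact (D.orthogonal s hs).A_zero
    · simp [H.A_zero]
  · have h0 := H.norm_ne k (by omega)
    refine (((D.norm_hasDerivAt ht hk).fun_div (D.norm_hasDerivAt ht (show k + 1 ≤ N by omega))
      h0).congr_of_eventuallyEq ?_).congr_deriv ?_
    · filter_upwards [hU] with s hs
      rw [(D.orthogonal s hs).norm_succ k (by omega),
        mul_div_cancel_right₀ _ ((D.orthogonal s hs).norm_ne k (by omega))]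
    · rw [H.norm_succ k (by omega), Nat.add_sub_cancel]
      push_cast
      field_simp
      ring

end IsDeformation

/-! ### From orthonormal to monic polynomials. -/

/-- The monic polynomials belonging to orthonormal ones. -/
def monicPart (P : ℕ → ℂ[X]) (k : ℕ) : ℂ[X] := C ((P k).coeff k)⁻¹ * P k

/-- Orthonormal polynomials are fixed only up to a sign that may vary arbitrarily with `t`. The
monic normalisation removes this choice, and `a k` enters only through its square. -/
lemma isMonicOrthogonal_monicPart {w : ℝ → ℂ} {L : ℂ[X] →ₗ[ℂ] ℂ}
    (hw : ∀ f g, bilin w f g = L (f * g)) {N : ℕ} {P : ℕ → ℂ[X]} {a b : ℕ → ℂ}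
    (hP : IsOrthonormalUpTo w N P) (hab : IsRecurrenceUpTo N P a b) :
    IsMonicOrthogonal L N (monicPart P) (fun k => ((P k).coeff k)⁻¹ ^ 2) (fun k => a k ^ 2) b := by
  have hnd : ∀ k ≤ N, (P k).natDegree = k := fun k hk =>
    natDegree_eq_of_degree_eq_some (hP.degree_eq k hk)
  have hl : ∀ k ≤ N, (P k).coeff k ≠ 0 := fun k hk =>
    coeff_ne_zero_of_eq_degree (hP.degree_eq k hk)
  have hL : ∀ i j, L (monicPart P i * monicPart P j)
      = ((P i).coeff i)⁻¹ * ((P j).coeff j)⁻¹ * bilin w (P i) (P j) := fun i j => by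
    rw [hw, ← linearMap_C_mul, monicPart, monicPart, C_mul]
    congr 1; ring
  -- Comparison of leading coefficients; it also forces `a (k + 1) ≠ 0`.
  have ha : ∀ k < N, a (k + 1) * (P (k + 1)).coeff (k + 1) = (P k).coeff k := fun k hk => by
    have h1 := congrArg (fun f => f.coeff (k + 1)) (hab.recurrence k hk)
    simp only [sub_mul, coeff_sub, coeff_C_mul, coeff_X_mul] at h1
    rw [coeff_eq_zero_of_natDegree_lt (p := P k) (n := k + 1) (by rw [hnd k hk.le]; omega),
      coeff_eq_zero_of_natDegree_lt (p := P (k - 1)) (n := k + 1) (by rw [hnd _ (by omega)]; omega)] at h1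
    linear_combination h1
  refine ⟨fun k hk => ?_, fun k hk => ?_, fun i hi j hj hij => ?_, fun k hk => ?_, fun k hk => ?_,
    ?_, fun k hk => ?_, fun k hk => ?_⟩
  · refine monic_C_mul_of_mul_leadingCoeff_eq_one ?_
    rw [leadingCoeff, hnd k hk, inv_mul_cancel₀ (hl k hk)]
  · rw [monicPart, natDegree_C_mul (inv_ne_zero (hl k hk)), hnd k hk]
  · rw [hL, hP.orthonormal i hi j hj, if_neg hij, mul_zero]
  · rw [hL, hP.orthonormal k hk k hk, if_pos rfl]; ring
  · exact pow_ne_zero _ (inv_ne_zero (hl k hk))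
  · rw [hab.a_zero]; simp
  · have h0 := hl (k + 1) hk
    have h1 := hl k hk.le
    rw [← ha k hk] at h1 ⊢
    have h2 : a (k + 1) ≠ 0 := left_ne_zero_of_mul h1
    field_simp
  · have h0 := hl (k + 1) hk
    have h1 := hl k hk.le
    have h2 : a (k + 1) ≠ 0 := fun h => h1 (by rw [← ha k hk, h, zero_mul])
    have e1 : ((P (k + 1)).coeff (k + 1))⁻¹ = ((P k).coeff k)⁻¹ * a (k + 1) := by
      rw [← ha k hk]; field_simp
    have e2 : a k * ((P k).coeff k)⁻¹ = a k ^ 2 * ((P (k - 1)).coeff (k - 1))⁻¹ := by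
      rcases k with _ | k
      · simp [hab.a_zero]
      · have h3 := hl k (by omega)
        rw [Nat.add_sub_cancel, ← ha k (by omega)] at *
        have h4 : a (k + 1) ≠ 0 := left_ne_zero_of_mul h3
        field_simp
    have e2' := congrArg (C : ℂ → ℂ[X]) e2
    have hr := hab.recurrence k hk
    rw [monicPart, monicPart, monicPart, e1]
    simp only [C_mul] at e2' ⊢
    linear_combination C ((P k).coeff k)⁻¹ * hr - P (k - 1) * e2'

lemma isDeformation_of_orthonormal {α μ ζ : ℂ} (hα : -1 < α.re) (hμ : -1 < μ.re) {N : ℕ}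
    {U : Set ℝ} (hU : IsOpen U) (hUpos : U ⊆ Set.Ioi 0) {P : ℝ → ℕ → ℂ[X]} {a b : ℝ → ℕ → ℂ}
    (hP : ∀ t ∈ U, IsOrthonormalUpTo (weight α μ ζ t) N (P t))
    (hab : ∀ t ∈ U, IsRecurrenceUpTo N (P t) (a t) (b t)) :
    IsDeformation (α + μ) U (moment α μ ζ) N (fun t => monicPart (P t))
      (fun t k => ((P t k).coeff k)⁻¹ ^ 2) (fun t k => a t k ^ 2) b where
  isOpen := hU
  ne_zero _ ht := (hUpos ht).ne'
  moment_deriv _ ht k := moment_hasDerivAt ζ hα hμ (hUpos ht) k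
  orthogonal t ht := isMonicOrthogonal_monicPart (bilin_weight_eq ζ hα hμ (hUpos ht))
    (hP t ht) (hab t ht)

/-! ### The first order system for `θ_n` and `κ_n`. -/

/-- The pair `(θ, κ)` solves at `t` the first order system of the deformation; `A` and `Φ` stand
for `a_n²` and `a_n² θ_{n-1}`. -/
def SatisfiesThetaKappaAt (α μ : ℂ) (n : ℕ) (θ κ : ℝ → ℂ) (t : ℝ) : Prop :=
  ∃ A Φ : ℂ,
    HasDerivAt θ ((2 * κ t + (θ t + 2 * n + 1 + α + μ + t) * θ t) / t) t ∧
    HasDerivAt κ ((κ t + Φ - A * θ t) / t) t ∧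
    θ t * Φ = κ t ^ 2 - μ ^ 2 * t ^ 2 / 4 ∧
    (θ t + t) * (Φ + A * t) = (κ t - (n + μ / 2) * t) * (κ t - (n + α + μ / 2) * t)

lemma hasDerivAt_ofReal (t : ℝ) : HasDerivAt (fun s : ℝ => (s : ℂ)) 1 t :=
  (hasDerivAt_id t).ofReal_comp

/-- Here `φ` is `θ_{n-1}`. The relations are `det_eq_zero` at `x = 0` and `x = t`, with one entry
rewritten through the Laguerre–Freud equation at `n - 1`; for `n = 0` both sides vanish. -/
lemma IsMonicOrthogonal.quadratic_relations {L : ℂ[X] →ₗ[ℂ] ℂ} {N : ℕ} {Q : ℕ → ℂ[X]}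
    {h A b : ℕ → ℂ} {α μ t : ℂ} (H : IsMonicOrthogonal L N Q h A b) (hL : IsPearson α μ t L)
    {n : ℕ} (hn : n + 1 ≤ N) {θ κ φ : ℂ} (hθ : θ = b n - 2 * n - 1 - α - μ - t)
    (hφ : φ = b (n - 1) - 2 * n + 1 - α - μ - t)
    (hκ : κ = (n + μ / 2) * t + A n - ∑ i ∈ Finset.range n, b i) :
    θ * (A n * φ) = κ ^ 2 - μ ^ 2 * t ^ 2 / 4 ∧
      (θ + t) * (A n * φ + A n * t) = (κ - (n + μ / 2) * t) * (κ - (n + α + μ / 2) * t) := by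
  rcases n with _ | m
  · rw [H.A_zero] at *
    simp only [Finset.range_zero, Finset.sum_empty] at hκ
    rw [hκ]; push_cast
    constructor <;> ring
  · have lf := H.laguerre_freud hL (n := m) (by omega)
    have d0 := H.det_eq_zero hL (m := m) (by omega) (x := 0) (by ring)
    have d1 := H.det_eq_zero hL (m := m) (by omega) (x := t) (by ring)
    rw [Nat.add_sub_cancel] at hφ
    rw [Finset.sum_range_succ] at *
    push_cast at *
    set S := ∑ i ∈ Finset.range m, b i
    constructor
    · rw [hθ, hκ, hφ]
      linear_combination d0 - (S + b m - (m + 1) * t - A (m + 1)) * lf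
    · rw [hθ, hκ, hφ]
      linear_combination d1 - ((m + 1) * t + S + b m - (m + 1) * t - A (m + 1)) * lf

lemma IsDeformation.satisfiesThetaKappaAt {α μ : ℂ} {U : Set ℝ} {m : ℝ → ℕ → ℂ} {n N : ℕ}
    {Q : ℝ → ℕ → ℂ[X]} {h a b : ℝ → ℕ → ℂ}
    (D : IsDeformation (α + μ) U m N Q h (fun t k => a t k ^ 2) b) {t : ℝ} (ht : t ∈ U)
    (hL : IsPearson α μ t (momentFunctional (m t))) (hn : n + 1 ≤ N) :
    SatisfiesThetaKappaAt α μ n (thetaFn α μ b n) (kappaFn μ a b n) t := by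
  have htc : (t : ℂ) ≠ 0 := by exact_mod_cast D.ne_zero t ht
  have H := D.orthogonal t ht
  obtain ⟨q1, q2⟩ := H.quadratic_relations hL hn (θ := thetaFn α μ b n t)
    (κ := kappaFn μ a b n t) rfl rfl rfl
  have lf := H.laguerre_freud hL hn
  refine ⟨_, _, ?_, ?_, q1, q2⟩
  -- The derivative of `b_n` brings in `a_{n+1}²`, which the Laguerre–Freud equation at `n` removes.
  · refine ((((((D.b_hasDerivAt ht hn).sub_const _).sub_const _).sub_const _).sub_const _).fun_sub
      (hasDerivAt_ofReal t)).congr_deriv ?_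
    simp only [thetaFn, kappaFn]
    rw [div_sub_one htc]
    congr 1
    linear_combination lf
  · refine ((((hasDerivAt_ofReal t).const_mul (n + μ / 2)).fun_add (D.A_hasDerivAt ht hn)).fun_sub
      (D.sum_hasDerivAt ht (show n ≤ N by omega))).congr_deriv ?_
    simp only [thetaFn, kappaFn]
    field_simp
    ring

/-! ### Hamilton equations and the fifth Painlevé equation. -/

section Hamiltonian

variable {α μ : ℂ} {n : ℕ} {v₁ v₂ v₃ v₄ : ℂ}

lemma hamiltonianPV_eq (hsum : v₁ + v₂ + v₃ + v₄ = 0)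
    (hv21 : v₂ - v₁ = -μ) (hv24 : v₂ - v₄ = n + α + 1) (hv23 : v₂ - v₃ = n + 1)
    (t : ℝ) (q p : ℂ) :
    hamiltonianPV v₁ v₂ v₃ v₄ t q p = (q * (q - 1) ^ 2 * p ^ 2
      - (-μ * (q - 1) ^ 2 - (2 * n + 2 + α + μ) * q * (q - 1) + t * q) * p
      + (n + 1 + μ) * (n + 1 + α + μ) * (q - 1)) / t := by
  -- Since the `v`'s sum to zero, `2(v₁ + v₂) = v₁ + v₂ - v₃ - v₄`, a combination of the given
  -- differences.
  have e1 : 2 * (v₁ + v₂) = 2 * n + 2 + α + μ := by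
    linear_combination hsum - hv21 + hv24 + hv23
  have e2 : v₃ - v₁ = -(n + 1 + μ) := by linear_combination hv21 - hv23
  have e3 : v₄ - v₁ = -(n + 1 + α + μ) := by linear_combination hv21 - hv24
  rw [hamiltonianPV, hv21, e1, e2, e3]
  ring

lemma deriv_hamiltonianPV_p (hsum : v₁ + v₂ + v₃ + v₄ = 0)
    (hv21 : v₂ - v₁ = -μ) (hv24 : v₂ - v₄ = n + α + 1) (hv23 : v₂ - v₃ = n + 1)
    (t : ℝ) (q p : ℂ) :
    deriv (fun y => hamiltonianPV v₁ v₂ v₃ v₄ t q y) p = (2 * q * (q - 1) ^ 2 * p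
      - (-μ * (q - 1) ^ 2 - (2 * n + 2 + α + μ) * q * (q - 1) + t * q)) / t := by
  simp only [hamiltonianPV_eq hsum hv21 hv24 hv23]
  have h := hasDerivAt_id p
  refine HasDerivAt.deriv (((((h.fun_pow 2).const_mul (q * (q - 1) ^ 2)).fun_sub
    (h.const_mul (-μ * (q - 1) ^ 2 - (2 * n + 2 + α + μ) * q * (q - 1) + t * q))).add_const
      ((n + 1 + μ) * (n + 1 + α + μ) * (q - 1))).div_const (t : ℂ) |>.congr_deriv ?_)
  simp only [id]
  ring

lemma deriv_hamiltonianPV_q (hsum : v₁ + v₂ + v₃ + v₄ = 0)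
    (hv21 : v₂ - v₁ = -μ) (hv24 : v₂ - v₄ = n + α + 1) (hv23 : v₂ - v₃ = n + 1)
    (t : ℝ) (q p : ℂ) :
    deriv (fun x => hamiltonianPV v₁ v₂ v₃ v₄ t x p) q =
      (((q - 1) ^ 2 + 2 * q * (q - 1)) * p ^ 2
      - (-2 * μ * (q - 1) - (2 * n + 2 + α + μ) * (2 * q - 1) + t) * p
      + (n + 1 + μ) * (n + 1 + α + μ)) / t := by
  simp only [hamiltonianPV_eq hsum hv21 hv24 hv23]
  have h := hasDerivAt_id q
  have h1 := h.sub_const 1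
  refine HasDerivAt.deriv ((((((h.fun_mul (h1.fun_pow 2)).mul_const (p ^ 2)).fun_sub
    (((((h1.fun_pow 2).const_mul (-μ)).fun_sub
      ((h.const_mul (2 * n + 2 + α + μ)).fun_mul h1)).fun_add
      (h.const_mul (t : ℂ))).mul_const p)).fun_add
      (h1.const_mul ((n + 1 + μ) * (n + 1 + α + μ)))).div_const (t : ℂ)).congr_deriv ?_)
  simp only [id]
  ring

lemma SatisfiesThetaKappaAt.satisfiesHamiltonAt (hsum : v₁ + v₂ + v₃ + v₄ = 0)
    (hv21 : v₂ - v₁ = -μ) (hv24 : v₂ - v₄ = n + α + 1) (hv23 : v₂ - v₃ = n + 1)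
    {a b : ℝ → ℕ → ℂ} {t : ℝ} (ht : t ≠ 0) (hθ : thetaFn α μ b n t ≠ 0)
    (hθt : thetaFn α μ b n t + t ≠ 0)
    (h : SatisfiesThetaKappaAt α μ n (thetaFn α μ b n) (kappaFn μ a b n) t) :
    SatisfiesHamiltonAt (hamiltonianPV v₁ v₂ v₃ v₄) (qFn α μ b n) (pFn α μ a b n) t := by
  have htc : (t : ℂ) ≠ 0 := by exact_mod_cast ht
  obtain ⟨A, Φ, hθ', hκ', e1, e2⟩ := h
  have hi := hasDerivAt_ofReal t
  -- Nonvanishing of `θ_n`, `θ_n + t` and `t` lets the quadratic relations be solved for `Φ` and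
  -- `A`, which closes the system.
  have hΦ : Φ = (kappaFn μ a b n t ^ 2 - μ ^ 2 * t ^ 2 / 4) / thetaFn α μ b n t := by
    rw [eq_div_iff hθ]; linear_combination e1
  have hA : A = ((kappaFn μ a b n t - (n + μ / 2) * t) * (kappaFn μ a b n t - (n + α + μ / 2) * t)
      / (thetaFn α μ b n t + t) - Φ) / t := by
    rw [eq_div_iff htc, eq_sub_iff_add_eq, eq_div_iff hθt]; linear_combination e2
  constructor
  · rw [deriv_hamiltonianPV_p hsum hv21 hv24 hv23]
    refine (hθ'.fun_div (hθ'.fun_add hi) hθt).congr_deriv ?_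
    simp only [qFn, pFn]
    generalize thetaFn α μ b n t = θ at *
    generalize kappaFn μ a b n t = κ at *
    field_simp
    ring
  · rw [deriv_hamiltonianPV_q hsum hv21 hv24 hv23]
    refine (((hθ'.fun_add hi).fun_mul ((hκ'.fun_sub ((hi.const_mul μ).div_const 2)).fun_add
      (hθ'.fun_mul (((((hi.const_add (1 + 2 * (n : ℂ))).add_const α).add_const μ)).fun_add
        hθ')))).fun_div (hi.fun_mul hθ') (mul_ne_zero htc hθ)).congr_deriv ?_
    simp only [qFn, pFn]
    rw [hA, hΦ]
    generalize thetaFn α μ b n t = θ at *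
    generalize kappaFn μ a b n t = κ at *
    field_simp
    ring

lemma satisfiesPVAt_of_hamilton (hsum : v₁ + v₂ + v₃ + v₄ = 0)
    (hv21 : v₂ - v₁ = -μ) (hv24 : v₂ - v₄ = n + α + 1) (hv23 : v₂ - v₃ = n + 1)
    {q p : ℝ → ℂ} {t : ℝ} (ht : t ≠ 0) (hq0 : q t ≠ 0) (hq1 : q t ≠ 1)
    (h : ∀ᶠ s in 𝓝 t, SatisfiesHamiltonAt (hamiltonianPV v₁ v₂ v₃ v₄) q p s) :
    SatisfiesPVAt (α ^ 2 / 2) (-μ ^ 2 / 2) (2 * n + α + 1 + μ) (-1 / 2) q t := by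
  have htc : (t : ℂ) ≠ 0 := by exact_mod_cast ht
  have hi := hasDerivAt_ofReal t
  have hq1' : q t - 1 ≠ 0 := sub_ne_zero.2 hq1
  obtain ⟨hq, hp⟩ := h.self_of_nhds
  rw [deriv_hamiltonianPV_p hsum hv21 hv24 hv23] at hq
  rw [deriv_hamiltonianPV_q hsum hv21 hv24 hv23] at hp
  have hd : deriv q =ᶠ[𝓝 t] fun s => (2 * q s * (q s - 1) ^ 2 * p s
      - (-μ * (q s - 1) ^ 2 - (2 * n + 2 + α + μ) * q s * (q s - 1) + s * q s)) / s := by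
    filter_upwards [h] with s hs
    rw [hs.1.deriv, deriv_hamiltonianPV_p hsum hv21 hv24 hv23]
  have h1 := hq.sub_const 1
  have h2 := ((((hq.const_mul 2).fun_mul (h1.fun_pow 2)).fun_mul hp).fun_sub
    ((((h1.fun_pow 2).const_mul (-μ)).fun_sub
      ((hq.const_mul (2 * n + 2 + α + μ)).fun_mul h1)).fun_add (hi.fun_mul hq))).fun_div hi htc
  have h3 := h2.congr_of_eventuallyEq hd
  refine ⟨ht, hq0, hq1, h.mono fun s hs => hs.1.differentiableAt, h3.differentiableAt, ?_⟩
  -- With `q'` and `p'` both expressed through `q` and `p`, the equation is a rational identity in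
  -- two free variables.
  rw [h3.deriv, hq.deriv]
  clear h3 h2 h1 hd hp hq
  generalize q t = x at *
  generalize p t = y at *
  field_simp
  ring

end Hamiltonian

/-! ### Reflection `s = -t` and the final assembly. -/

lemma SatisfiesPVAt.comp_neg {α₁ α₂ α₃ α₄ : ℂ} {y : ℝ → ℂ} {t : ℝ}
    (h : SatisfiesPVAt α₁ α₂ α₃ α₄ y t) :
    SatisfiesPVAt α₁ α₂ (-α₃) α₄ (fun s => y (-s)) (-t) := by
  obtain ⟨h0, h1, h2, h3, h4, h5⟩ := h
  have e1 : deriv (fun s => y (-s)) = fun s => -deriv y (-s) := funext fun s => deriv_comp_neg y s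
  have e2 : deriv (fun s => -deriv y (-s)) (-t) = deriv (deriv y) t := by
    rw [deriv.fun_neg, deriv_comp_neg (deriv y), neg_neg, neg_neg]
  refine ⟨neg_ne_zero.2 h0, by simpa using h1, by simpa using h2, ?_, ?_, ?_⟩
  · have : Tendsto (fun s : ℝ => -s) (𝓝 (-t)) (𝓝 t) := by
      simpa using (continuous_neg.tendsto (-t) : Tendsto (fun s : ℝ => -s) _ _)
    filter_upwards [this.eventually h3] with s hs
    exact hs.comp s differentiableAt_id.neg
  · rw [e1]
    have : DifferentiableAt ℝ (deriv y) (- -t) := by rwa [neg_neg]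
    exact (this.comp (-t) differentiableAt_id.neg).neg
  · rw [e1, e2, h5]
    push_cast
    simp only [neg_neg, neg_sq, div_neg, neg_mul, neg_div]

lemma SatisfiesHamiltonAt.comp_neg {H : ℝ → ℂ → ℂ → ℂ} {q p : ℝ → ℂ} {t : ℝ}
    (h : SatisfiesHamiltonAt H q p t) :
    SatisfiesHamiltonAt (fun s x y => -H (-s) x y) (fun s => q (-s)) (fun s => p (-s)) (-t) := by
  obtain ⟨h1, h2⟩ := h
  rw [← neg_neg t] at h1 h2
  have k1 := h1.scomp (-t) (hasDerivAt_neg (-t))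
  have k2 := h2.scomp (-t) (hasDerivAt_neg (-t))
  refine ⟨k1.congr_deriv ?_, k2.congr_deriv ?_⟩
  · rw [deriv.fun_neg, neg_one_smul]
  · rw [deriv.fun_neg, neg_one_smul]

end
end LaguerrePV

theorem mainTheorem2
    (α μ ζ : ℂ) (hα : -1 < α.re) (hμ : -1 < μ.re) (n : ℕ)
    (v₁ v₂ v₃ v₄ : ℂ) (hsum : v₁ + v₂ + v₃ + v₄ = 0)
    (hv21 : v₂ - v₁ = -μ) (hv34 : v₃ - v₄ = α)
    (hv24 : v₂ - v₄ = n + α + 1) (hv23 : v₂ - v₃ = n + 1)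
    (U : Set ℝ) (hU : IsOpen U) (hUpos : U ⊆ Set.Ioi 0)
    (P : ℝ → ℕ → Polynomial ℂ) (a b : ℝ → ℕ → ℂ)
    (hP : ∀ t ∈ U, LaguerrePV.IsOrthonormalUpTo (LaguerrePV.weight α μ ζ t) (n + 1) (P t))
    (hab : ∀ t ∈ U, LaguerrePV.IsRecurrenceUpTo (n + 1) (P t) (a t) (b t))
    (t : ℝ) (ht : t ∈ U)
    (hθ : LaguerrePV.thetaFn α μ b n t ≠ 0)
    (hθt : LaguerrePV.thetaFn α μ b n t + t ≠ 0) :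
    let θ : ℝ → ℂ := LaguerrePV.thetaFn α μ b n
    let κ : ℝ → ℂ := LaguerrePV.kappaFn μ a b n
    let q : ℝ → ℂ := LaguerrePV.qFn α μ b n
    let p : ℝ → ℂ := LaguerrePV.pFn α μ a b n
    let H : ℝ → ℂ → ℂ → ℂ := LaguerrePV.hamiltonianPV v₁ v₂ v₃ v₄
    -- the Hamilton equations
    LaguerrePV.SatisfiesHamiltonAt H q p t ∧
    -- the fifth Painlevé equation for `q`
    LaguerrePV.SatisfiesPVAt (α ^ 2 / 2) (-μ ^ 2 / 2) (2 * n + α + 1 + μ) (-1 / 2) q t ∧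
    -- both in the reflected variable `s = -t`, where `s H` is replaced by its value at `-s`
    LaguerrePV.SatisfiesHamiltonAt (fun s x y => -H (-s) x y)
      (fun s => q (-s)) (fun s => p (-s)) (-t) ∧
    LaguerrePV.SatisfiesPVAt (α ^ 2 / 2) (-μ ^ 2 / 2) (-(2 * n + α + 1 + μ)) (-1 / 2)
      (fun s => q (-s)) (-t) ∧
    -- `θ_n` and `κ_n` in terms of `q` and `p`
    θ t = t * q t / (1 - q t) ∧
    κ t = t * p t * q t - (t : ℂ) ^ 2 / (1 - q t) ^ 2
      + t * (t + μ / 2 - q t * (2 * n + α + 1 + 3 * μ / 2)) / (1 - q t) := by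
  open LaguerrePV in
  have D := LaguerrePV.isDeformation_of_orthonormal hα hμ hU hUpos hP hab
  have hsys : ∀ s ∈ U, LaguerrePV.SatisfiesThetaKappaAt α μ n
      (LaguerrePV.thetaFn α μ b n) (LaguerrePV.kappaFn μ a b n) s :=
    fun s hs => D.satisfiesThetaKappaAt hs
      (LaguerrePV.momentFunctional_isPearson ζ hα hμ (hUpos hs)) le_rfl
  have htc : (t : ℂ) ≠ 0 := by exact_mod_cast D.ne_zero t ht
  have hcont : ContinuousAt (LaguerrePV.thetaFn α μ b n) t := by
    obtain ⟨A, Φ, h, -⟩ := hsys t ht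
    exact h.continuousAt
  -- The second derivative of `q` needs the Hamilton equations on a neighbourhood; the two
  -- nonvanishing conditions persist there by continuity of `θ_n`.
  have hH : ∀ᶠ s in nhds t, LaguerrePV.SatisfiesHamiltonAt (LaguerrePV.hamiltonianPV v₁ v₂ v₃ v₄)
      (LaguerrePV.qFn α μ b n) (LaguerrePV.pFn α μ a b n) s := by
    filter_upwards [hU.mem_nhds ht, hcont.eventually_ne hθ,
      (hcont.add (LaguerrePV.hasDerivAt_ofReal t).continuousAt).eventually_ne hθt] with s hs h1 h2
    exact (hsys s hs).satisfiesHamiltonAt hsum hv21 hv24 hv23 (D.ne_zero s hs) h1 h2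
  have hq : 1 - LaguerrePV.qFn α μ b n t = t / (LaguerrePV.thetaFn α μ b n t + t) := by
    rw [LaguerrePV.qFn, eq_div_iff hθt, sub_mul, div_mul_cancel₀ _ hθt]; ring
  have hPV := LaguerrePV.satisfiesPVAt_of_hamilton hsum hv21 hv24 hv23 (D.ne_zero t ht)
    (div_ne_zero hθ hθt) (fun h => by
      rw [h, sub_self] at hq
      exact div_ne_zero htc hθt hq.symm) hH
  refine ⟨hH.self_of_nhds, hPV, hH.self_of_nhds.comp_neg, hPV.comp_neg, ?_, ?_⟩
  · rw [hq, LaguerrePV.qFn]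
    field_simp
  · rw [hq, LaguerrePV.qFn, LaguerrePV.pFn]
    generalize LaguerrePV.thetaFn α μ b n t = θ at *
    generalize LaguerrePV.kappaFn μ a b n t = κ at *
    field_simp
    ring
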